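/- Let $\rho>0$ and let $G:\,]0,\infty[\,\to\mathbb{R}$ be a completely monotonic function (i.e. $G$ is infinitely differentiable and $(-1)^n G^{(n)}(t)\ge 0$ for all $t>0$, $n\ge 0$) that is locally integrable on $[0,\infty[$ and satisfies $G_\infty:=\lim_{t\to\infty}G(t)>0$. For $\operatorname{Re}p>0$ let $$Q(p)=p\int_0^\infty e^{-pt}G(t)\,dt,\qquad \kappa(p)=\rho^{1/2}\,\frac{p}{Q(p)^{1/2}}$$ with the principal square root. Then there exist a number $B\ge 0$ and a positive Radon measure $\nu$ on $[0,\infty[$ with $\int_{]0,\infty[}\nu(dr)/(1+r)<\infty$ such that $$\kappa(p)=B\,p+\beta(p),\qquad \beta(p)=p\int_{]0,\infty[}\frac{\nu(dr)}{p+r}\qquad(\operatorname{Re}p>0).$$ For every such pair $(B,\nu)$, define the wavefront speed by $c_\infty:=1/B\in\,]0,\infty]$ (with $1/0=\infty$). If $G_0:=\lim_{t\to 0+}G(t)$ is finite, then $B=(\rho/G_0)^{1/2}$ and $c_\infty=(G_0/\rho)^{1/2}$; otherwise $B=0$ and $c_\infty=\infty$. -/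

import Mathlib

open scoped ContDiff

namespace Viscoelastic

/-- `f` is completely monotonic on the open half-line `t > 0`: it has derivatives of all orders
there and `(-1)^n f^(n)(t) ≥ 0` for all `t > 0` and all `n ≥ 0`. Values of `f` at `t ≤ 0` play
no role. -/
def IsCM (f : ℝ → ℝ) : Prop :=
  ContDiffOn ℝ ∞ f (Set.Ioi 0) ∧
    ∀ n : ℕ, ∀ t : ℝ, 0 < t → 0 ≤ (-1 : ℝ) ^ n * iteratedDeriv n f t

/-- Locally integrable completely monotonic functions (LICM); local integrability refers to
`[0, ∞)`. -/
def IsLICM (f : ℝ → ℝ) : Prop :=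
  IsCM f ∧ MeasureTheory.LocallyIntegrableOn f (Set.Ici 0)

/-- The class of positive Radon measures `ν` on `[0, ∞)` (regarded as measures on `ℝ` that do not
charge `(-∞, 0)`) with `∫_{(0,∞)} ν(dr) / (1 + r) < ∞`. -/
def IsSpectralMeasure (ν : MeasureTheory.Measure ℝ) : Prop :=
  MeasureTheory.IsLocallyFiniteMeasure ν ∧ ν (Set.Iio 0) = 0 ∧
    ∫⁻ r in Set.Ioi (0 : ℝ), ENNReal.ofReal (1 / (1 + r)) ∂ν < ⊤

/-- The Laplace transform `∫_0^∞ e^{-p t} f(t) dt`. -/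
noncomputable def laplace (f : ℝ → ℝ) (p : ℂ) : ℂ :=
  ∫ t in Set.Ioi (0 : ℝ), Complex.exp (-p * (t : ℂ)) * (f t : ℂ)

/-- The complex modulus `Q(p) = p G̃(p)` of a medium with relaxation modulus `G`. -/
noncomputable def modulus (G : ℝ → ℝ) (p : ℂ) : ℂ :=
  p * laplace G p

/-- The complex wave number function `κ(p) = ρ^{1/2} p / Q(p)^{1/2}` (principal square roots),
considered for `Re p > 0`. For LICM `G ≢ 0` one has `Re Q(p) > 0` there. -/
noncomputable def waveNumber (ρ : ℝ) (G : ℝ → ℝ) (p : ℂ) : ℂ :=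
  ((Real.sqrt ρ : ℝ) : ℂ) * p / modulus G p ^ (1 / 2 : ℂ)

/-- The dispersion-attenuation function `β(p) = p ∫_{(0,∞)} ν(dr) / (p + r)`. -/
noncomputable def dispersionAttenuation (ν : MeasureTheory.Measure ℝ) (p : ℂ) : ℂ :=
  p * ∫ r in Set.Ioi (0 : ℝ), 1 / (p + (r : ℂ)) ∂ν

/-- The pair `(B, ν)` represents the wave number function: `B ≥ 0`, `ν` is a spectral measure, and
`κ(p) = B p + β(p)` on the half-plane `Re p > 0`. -/
def RepresentsWaveNumber (ρ : ℝ) (G : ℝ → ℝ) (B : ℝ) (ν : MeasureTheory.Measure ℝ) : Prop :=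
  0 ≤ B ∧ IsSpectralMeasure ν ∧
    ∀ p : ℂ, 0 < p.re → waveNumber ρ G p = (B : ℂ) * p + dispersionAttenuation ν p

/-- The wavefront speed `c_∞ = 1 / B`, with values in `(0, ∞]`; it is `∞` for `B = 0`. -/
noncomputable def wavefrontSpeed (B : ℝ) : ENNReal :=
  (ENNReal.ofReal B)⁻¹

end Viscoelastic

namespace Viscoelastic

open Polynomial

/-! Existence amounts to showing that `1 / √Q` is a Stieltjes function. In the variable `z = 1 - p`,
complete monotonicity becomes a condition on power series: integration by parts makes the Taylor
coefficients `a n` of the Laplace transform at `p = 1` a completely monotonic sequence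
(`isCMSeq_laplaceCoeff`), and such sequences are the moment sequences of finite measures on `[0, 1]`
(`exists_measure_of_isCMSeq`). A series with moments of `μ` sums to `∫ μ(dx) / (1 - x z)`, which is
a Stieltjes function under `x = 1 / (1 + r)`.

Here `Q = (1 - z) ∑ a n z^n`, and `Q^{-1/2}` is a positive multiple of `∫ s^{-1/2} / (Q + s) ds`.
Since `Q + s = (1 - z) ∑ (a n + s) z^n`, it suffices that the reciprocal of `1 - z` times a
completely monotonic series is completely monotonic (`IsCMSeq.inv`). This is algebra: for reciprocal
power series the Hankel forms of the shifted coefficients are congruent up to sign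
(`exists_momentFunctional_sq_eq_neg`), and complete monotonicity is positivity of the functional on
`X p²` and `(1 - X) p²`.

The resulting identity on `0 < p ≤ 1` extends to the half-plane by the identity theorem, the
principal root being analytic because `Re Q > 0`. The atom at `x = 0` supplies `B`; there is none at
`x = 1`, because `Q ≥ Ginf > 0` keeps `Q^{-1/2}` bounded as `p → 0+`.

For any representing pair, `κ(p) / p = √ρ / √Q(p)` tends to `B` along real `p → ∞`
(`RepresentsWaveNumber.tendsto`), while `Q(p)` tends to the limit of `G` at `0+`, finite or not. -/

/-! ### Moment functionals and completely monotonic sequences -/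

/-- The linear functional on polynomials with moments `X ^ n ↦ c n`. -/
noncomputable def momentFunctional (c : ℕ → ℝ) : ℝ[X] →ₗ[ℝ] ℝ :=
  Polynomial.lsum fun n => c n • (LinearMap.id : ℝ →ₗ[ℝ] ℝ)

theorem momentFunctional_monomial (c : ℕ → ℝ) (n : ℕ) (r : ℝ) :
    momentFunctional c (monomial n r) = c n * r := by
  simp [momentFunctional]

theorem momentFunctional_C_mul_X_pow (c : ℕ → ℝ) (n : ℕ) (r : ℝ) :
    momentFunctional c (C r * X ^ n) = c n * r := by
  rw [C_mul_X_pow_eq_monomial, momentFunctional_monomial]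

theorem momentFunctional_X_pow (c : ℕ → ℝ) (n : ℕ) : momentFunctional c (X ^ n) = c n := by
  simpa using momentFunctional_C_mul_X_pow c n 1

theorem momentFunctional_C_mul (c : ℕ → ℝ) (r : ℝ) (p : ℝ[X]) :
    momentFunctional c (C r * p) = r * momentFunctional c p := by
  rw [← smul_eq_C_mul, map_smul, smul_eq_mul]

theorem momentFunctional_X_mul (c : ℕ → ℝ) (p : ℝ[X]) :
    momentFunctional c (X * p) = momentFunctional (fun n => c (n + 1)) p := by
  induction p using Polynomial.induction_on' with
  | add p q hp hq => rw [mul_add, map_add, map_add, hp, hq]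
  | monomial n r => rw [X_mul_monomial, momentFunctional_monomial, momentFunctional_monomial]

theorem momentFunctional_smul (c : ℕ → ℝ) (r : ℝ) (p : ℝ[X]) :
    momentFunctional (fun n => r * c n) p = r * momentFunctional c p := by
  induction p using Polynomial.induction_on' with
  | add p q hp hq => rw [map_add, map_add, hp, hq, mul_add]
  | monomial n s => rw [momentFunctional_monomial, momentFunctional_monomial, mul_assoc]

theorem momentFunctional_add (c d : ℕ → ℝ) (p : ℝ[X]) :
    momentFunctional (fun n => c n + d n) p = momentFunctional c p + momentFunctional d p := by
  induction p using Polynomial.induction_on' with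
  | add p q hp hq => rw [map_add, map_add, map_add, hp, hq]; ring
  | monomial n s => simp only [momentFunctional_monomial]; ring

theorem momentFunctional_sub (c d : ℕ → ℝ) (p : ℝ[X]) :
    momentFunctional (fun n => c n - d n) p = momentFunctional c p - momentFunctional d p := by
  induction p using Polynomial.induction_on' with
  | add p q hp hq => rw [map_add, map_add, map_add, hp, hq]; ring
  | monomial n s => simp only [momentFunctional_monomial]; ring

theorem momentFunctional_one (p : ℝ[X]) : momentFunctional (fun _ => 1) p = p.eval 1 := by
  induction p using Polynomial.induction_on' with
  | add p q hp hq => rw [map_add, eval_add, hp, hq]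
  | monomial n s => simp [momentFunctional_monomial]

/-- Completely monotonic sequences: all iterated differences `(1 - shift)^m c` are nonnegative. -/
def IsCMSeq (c : ℕ → ℝ) : Prop :=
  ∀ k m : ℕ, 0 ≤ momentFunctional c (X ^ k * (1 - X) ^ m)

theorem IsCMSeq.nonneg {c : ℕ → ℝ} (h : IsCMSeq c) (n : ℕ) : 0 ≤ c n := by
  simpa [momentFunctional_X_pow] using h n 0

theorem IsCMSeq.antitone {c : ℕ → ℝ} (h : IsCMSeq c) : Antitone c := by
  refine antitone_nat_of_succ_le fun n => ?_
  have := h n 1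
  rw [pow_one, mul_sub, mul_one, ← pow_succ, map_sub, momentFunctional_X_pow,
    momentFunctional_X_pow] at this
  linarith

/-- Constant sequences are multiples of the moment sequence of the Dirac mass at `1`, so their
functional is evaluation at `1`. -/
theorem IsCMSeq.add_const {c : ℕ → ℝ} (h : IsCMSeq c) {s : ℝ} (hs : 0 ≤ s) :
    IsCMSeq fun n => c n + s := by
  intro k m
  have e : (fun n => c n + s) = fun n => c n + s * (fun _ : ℕ => (1 : ℝ)) n := by simp
  rw [e, momentFunctional_add, momentFunctional_smul, momentFunctional_one]
  refine add_nonneg (h k m) (mul_nonneg hs ?_)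
  rcases m with _ | m <;> simp

/-- Split the exponents by parity. With mixed parity the polynomial already has one of the two
forms; with equal parity, multiplying by `X + (1 - X) = 1` gives a sum of both. -/
theorem isCMSeq_of_forall_sq_nonneg {c : ℕ → ℝ}
    (h₁ : ∀ p : ℝ[X], 0 ≤ momentFunctional c (X * (p * p)))
    (h₂ : ∀ p : ℝ[X], 0 ≤ momentFunctional c ((1 - X) * (p * p))) : IsCMSeq c := by
  intro k m
  obtain ⟨a, rfl | rfl⟩ := Nat.even_or_odd' k <;> obtain ⟨b, rfl | rfl⟩ := Nat.even_or_odd' m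
  · refine (add_nonneg (h₁ (X ^ a * (1 - X) ^ b)) (h₂ (X ^ a * (1 - X) ^ b))).trans_eq ?_
    rw [← map_add]; congr 1; ring
  · convert h₂ (X ^ a * (1 - X) ^ b) using 2; ring
  · convert h₁ (X ^ a * (1 - X) ^ b) using 2; ring
  · refine (add_nonneg (h₁ (X ^ a * (1 - X) ^ b * (1 - X)))
      (h₂ (X ^ a * (1 - X) ^ b * X))).trans_eq ?_
    rw [← map_add]; congr 1; ring

/-! ### Hankel forms of reciprocal power series -/

/-- The reversed truncation `∑_{k ≤ i} c_{i-k} X^k` of a power series. -/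
noncomputable def revTrunc (c : PowerSeries ℝ) : ℕ → ℝ[X]
  | 0 => C (PowerSeries.coeff 0 c)
  | i + 1 => X * revTrunc c i + C (PowerSeries.coeff (i + 1) c)

/-- The shifted power series with coefficients `c_{n+j}`. -/
noncomputable def shiftSeries (j : ℕ) (c : PowerSeries ℝ) : PowerSeries ℝ :=
  PowerSeries.mk fun n => PowerSeries.coeff (n + j) c

theorem X_mul_shiftSeries_succ (j : ℕ) (c : PowerSeries ℝ) :
    PowerSeries.X * shiftSeries (j + 1) c =
      shiftSeries j c - PowerSeries.C (PowerSeries.coeff j c) := by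
  ext n
  rcases n with _ | n
  · simp [shiftSeries]
  · rw [PowerSeries.coeff_succ_X_mul]
    simp [shiftSeries, add_assoc, add_comm 1 j]

/-- Pairing with reversed truncations is a Cauchy product, so it acts on generating series as
multiplication by `c`. -/
theorem momentFunctional_revTrunc_mul (c : PowerSeries ℝ) (e : ℕ → ℝ) (i : ℕ) (q : ℝ[X]) :
    momentFunctional e (revTrunc c i * q) =
      PowerSeries.coeff i (c * PowerSeries.mk fun n => momentFunctional e (X ^ n * q)) := by
  induction i generalizing q with
  | zero => simp [revTrunc, momentFunctional_C_mul]
  | succ i ih =>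
    have h : revTrunc c (i + 1) * q =
        revTrunc c i * (X * q) + C (PowerSeries.coeff (i + 1) c) * q := by
      rw [revTrunc]; ring
    rw [h, map_add, ih, momentFunctional_C_mul, PowerSeries.coeff_mul, PowerSeries.coeff_mul,
      Finset.Nat.antidiagonal_succ']
    simp [pow_succ, mul_assoc, add_comm]

/-- The Hankel form of the shifted coefficients has generating function `(c(x) - c(y)) / (x - y)`.
As `e = 1 / c`, this equals `-c(x) c(y) (e(x) - e(y)) / (x - y)`; the claim compares coefficients of
`x^i y^j`. -/
theorem momentFunctional_revTrunc_mul_revTrunc {c e : PowerSeries ℝ} (h : c * e = 1) (i j : ℕ) :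
    momentFunctional (fun n => PowerSeries.coeff (n + 1) e) (revTrunc c i * revTrunc c j) =
      -PowerSeries.coeff (i + j + 1) c := by
  -- One row of the form at a time, as a series in the other variable. Multiplying by `X` below
  -- turns shifts into differences.
  have key : ∀ j, c * (PowerSeries.mk fun n => momentFunctional
      (fun n => PowerSeries.coeff (n + 1) e) (X ^ n * revTrunc c j)) = -shiftSeries (j + 1) c := by
    intro j
    induction j with
    | zero =>
      refine mul_left_cancel₀ (PowerSeries.X_ne_zero (R := ℝ)) ?_
      have h1 : (PowerSeries.mk fun n => momentFunctional
          (fun n => PowerSeries.coeff (n + 1) e) (X ^ n * revTrunc c 0)) =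
          PowerSeries.C (PowerSeries.coeff 0 c) * shiftSeries 1 e := by
        ext n
        simp only [PowerSeries.coeff_mk, PowerSeries.coeff_C_mul, revTrunc, shiftSeries]
        rw [mul_comm, momentFunctional_C_mul_X_pow, mul_comm]
      have h0 : shiftSeries 0 c = c := by ext; simp [shiftSeries]
      have h0' : shiftSeries 0 e = e := by ext; simp [shiftSeries]
      have hce : PowerSeries.coeff 0 c * PowerSeries.coeff 0 e = 1 := by
        have := congrArg (PowerSeries.coeff 0) h
        simpa using this
      rw [h1, mul_neg, X_mul_shiftSeries_succ, h0]
      calc PowerSeries.X * (c * (PowerSeries.C (PowerSeries.coeff 0 c) * shiftSeries 1 e))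
          = PowerSeries.C (PowerSeries.coeff 0 c) * c * (PowerSeries.X * shiftSeries (0 + 1) e) := by
            ring
        _ = PowerSeries.C (PowerSeries.coeff 0 c) * (c * e) -
            c * PowerSeries.C (PowerSeries.coeff 0 c * PowerSeries.coeff 0 e) := by
            rw [X_mul_shiftSeries_succ, h0', map_mul]; ring
        _ = _ := by rw [h, hce]; simp
    | succ j ih =>
      refine mul_left_cancel₀ (PowerSeries.X_ne_zero (R := ℝ)) ?_
      have h1 : PowerSeries.X * (PowerSeries.mk fun n => momentFunctional
          (fun n => PowerSeries.coeff (n + 1) e) (X ^ n * revTrunc c (j + 1))) =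
          (PowerSeries.mk fun n => momentFunctional
          (fun n => PowerSeries.coeff (n + 1) e) (X ^ n * revTrunc c j)) +
          PowerSeries.C (PowerSeries.coeff (j + 1) c) * e := by
        have hs : ∀ n, momentFunctional (fun n => PowerSeries.coeff (n + 1) e) (X ^ n * revTrunc c (j + 1))
          = momentFunctional (fun n => PowerSeries.coeff (n + 1) e) (X ^ (n + 1) * revTrunc c j)
            + PowerSeries.coeff (j + 1) c * PowerSeries.coeff (n + 1) e := by
          intro n
          rw [revTrunc, mul_add, map_add, mul_comm (X ^ n) (C _), momentFunctional_C_mul_X_pow,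
            pow_succ, mul_assoc, mul_comm (PowerSeries.coeff (j + 1) c)]
        ext n
        rcases n with _ | n
        -- The constant term has to vanish on the right as well: it is exactly the coefficient of
        -- degree `j + 1` in `c * e = 1`.
        · have hz : PowerSeries.coeff (j + 1) (c * e) = 0 := by
            rw [h, PowerSeries.coeff_one]; simp
          have := momentFunctional_revTrunc_mul c (fun n => PowerSeries.coeff (n + 1) e) j 1
          rw [mul_one] at this
          rw [PowerSeries.coeff_mul, Finset.Nat.antidiagonal_succ'] at hz
          rw [PowerSeries.coeff_mul] at this
          simp [momentFunctional_X_pow] at this hz ⊢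
          rw [this]; linarith
        · rw [PowerSeries.coeff_succ_X_mul]
          simp [hs]
      rw [mul_left_comm, h1, mul_add, ih, mul_left_comm, h, mul_neg, X_mul_shiftSeries_succ]
      ring
  rw [momentFunctional_revTrunc_mul, key]
  simp [shiftSeries, add_assoc]

theorem exists_momentFunctional_sq_eq_neg {c e : PowerSeries ℝ} (h : c * e = 1) (p : ℝ[X]) :
    ∃ q : ℝ[X], momentFunctional (fun n => PowerSeries.coeff (n + 1) c) (p * p) =
      -momentFunctional (fun n => PowerSeries.coeff (n + 1) e) (q * q) := by
  let R : ℝ[X] →ₗ[ℝ] ℝ[X] := Polynomial.lsum fun n => LinearMap.toSpanSingleton ℝ ℝ[X] (revTrunc c n)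
  have hR : ∀ n r, R (monomial n r) = C r * revTrunc c n := by
    intro n r; simp [R, smul_eq_C_mul]
  have key : ∀ p q : ℝ[X], momentFunctional (fun n => PowerSeries.coeff (n + 1) c) (p * q) =
      -momentFunctional (fun n => PowerSeries.coeff (n + 1) e) (R p * R q) := by
    intro p q
    induction p using Polynomial.induction_on' with
    | add p p' hp hp' => rw [add_mul, map_add, hp, hp', map_add, add_mul, map_add]; ring
    | monomial i r =>
      induction q using Polynomial.induction_on' with
      | add p p' hp hp' => rw [mul_add, map_add, hp, hp', map_add, mul_add, map_add]; ring
      | monomial j s =>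
        rw [monomial_mul_monomial, momentFunctional_monomial, hR, hR,
          show C r * revTrunc c i * (C s * revTrunc c j) =
            C r * (C s * (revTrunc c i * revTrunc c j)) by ring,
          momentFunctional_C_mul, momentFunctional_C_mul,
          momentFunctional_revTrunc_mul_revTrunc h]
        ring
  exact ⟨R p, key p p⟩

end Viscoelastic

namespace Viscoelastic

open Polynomial MeasureTheory Filter Topology unitInterval

/-! ### The Hausdorff moment problem -/

/-- The ratio is the product of `(k - i) / (N - i)` over `i < d`. Replacing factor `i` by `k / N`
costs at most `i / N`, and these costs add up to at most `d² / N`. -/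
theorem abs_descFactorial_div_sub_pow_le {k N : ℕ} (hk : k ≤ N) (d : ℕ) (hd : d ≤ N) :
    |(k.descFactorial d : ℝ) / N.descFactorial d - ((k : ℝ) / N) ^ d| ≤ (d : ℝ) ^ 2 / N := by
  induction d with
  | zero => simp
  | succ d ih =>
    have hdN : d < N := hd
    have hN : (0 : ℝ) < N := by exact_mod_cast (Nat.zero_le d).trans_lt hdN
    have hND : (0 : ℝ) < (N : ℝ) - d := by
      have : (d : ℝ) < N := by exact_mod_cast hdN
      linarith
    have hkN : (k : ℝ) ≤ N := by exact_mod_cast hk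
    set r : ℝ := (k.descFactorial d : ℝ) / N.descFactorial d with hr
    have hpos : (0 : ℝ) < N.descFactorial d := by
      exact_mod_cast Nat.pos_of_ne_zero fun h => by
        rw [Nat.descFactorial_eq_zero_iff_lt] at h; omega
    have hr0 : 0 ≤ r := by positivity
    have hr1 : r ≤ 1 := by
      rw [hr, div_le_one hpos]
      exact_mod_cast Nat.descFactorial_le d hk
    have hx0 : 0 ≤ (k : ℝ) / N := by positivity
    have hx1 : (k : ℝ) / N ≤ 1 := by rw [div_le_one hN]; exact hkN
    have hstep : (k.descFactorial (d + 1) : ℝ) / N.descFactorial (d + 1) =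
        r * (((k : ℝ) - d) / (N - d)) := by
      rw [Nat.descFactorial_succ, Nat.descFactorial_succ, Nat.cast_mul, Nat.cast_mul,
        Nat.cast_sub hdN.le]
      rcases le_or_gt d k with h | h
      · rw [Nat.cast_sub h, hr]; field_simp
      · have : k.descFactorial d = 0 := by rwa [Nat.descFactorial_eq_zero_iff_lt]
        simp [hr, this]
    have hmain : |r * (((k : ℝ) - d) / (N - d)) - r * (k / N)| ≤ d / N := by
      rcases le_or_gt d k with h | h
      · have e : ((k : ℝ) - d) / (N - d) - k / N = -(d / N * ((N - k) / (N - d))) := by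
          field_simp; ring
        have h1 : ((N : ℝ) - k) / (N - d) ≤ 1 := by
          rw [div_le_one hND]
          have : (d : ℝ) ≤ k := by exact_mod_cast h
          linarith
        have h0 : 0 ≤ ((N : ℝ) - k) / (N - d) := div_nonneg (by linarith) hND.le
        rw [← mul_sub, e, abs_mul, abs_neg, abs_of_nonneg hr0,
          abs_of_nonneg (mul_nonneg (by positivity) h0)]
        calc r * (d / N * ((N - k) / (N - d))) ≤ 1 * (d / N * 1) := by gcongr
          _ = _ := by ring
      · have : k.descFactorial d = 0 := by rwa [Nat.descFactorial_eq_zero_iff_lt]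
        have : r = 0 := by simp [hr, this]
        simp only [this, zero_mul, sub_self, abs_zero]; positivity
    have h2 : |r * (k / N) - ((k : ℝ) / N) ^ d * (k / N)| ≤ (d : ℝ) ^ 2 / N := by
      rw [← sub_mul, abs_mul, abs_of_nonneg hx0]
      calc _ ≤ |r - ((k : ℝ) / N) ^ d| * 1 := by gcongr
        _ ≤ _ := by rw [mul_one]; exact ih hdN.le
    rw [hstep, pow_succ]
    calc _ ≤ |r * (((k : ℝ) - d) / (N - d)) - r * (k / N)| +
          |r * (k / N) - ((k : ℝ) / N) ^ d * (k / N)| := abs_sub_le _ _ _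
      _ ≤ d / N + (d : ℝ) ^ 2 / N := add_le_add hmain h2
      _ ≤ _ := by
        rw [← add_div]; gcongr; push_cast; nlinarith [(Nat.cast_nonneg d : (0 : ℝ) ≤ d)]

/-- Factorial moments of the binomial law: `k.choose d * N.choose k = N.choose d * (N - d).choose (k
- d)`, and the remaining sum is `(X + (1 - X)) ^ (N - d) = 1`. -/
theorem sum_choose_mul_choose_mul_pow (N d : ℕ) (hd : d ≤ N) :
    ∑ k ∈ Finset.range (N + 1), C ((k.choose d * N.choose k : ℕ) : ℝ) * (X ^ k * (1 - X) ^ (N - k))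
      = C (N.choose d : ℝ) * X ^ d := by
  have h1 : ∑ k ∈ Finset.range (N + 1),
      C ((k.choose d * N.choose k : ℕ) : ℝ) * (X ^ k * (1 - X) ^ (N - k)) =
      ∑ k ∈ Finset.Ico d (N + 1),
      C ((k.choose d * N.choose k : ℕ) : ℝ) * (X ^ k * (1 - X) ^ (N - k)) := by
    symm
    apply Finset.sum_subset
    · intro k hk; simp at hk ⊢; omega
    · intro k hk hk'
      have : k < d := by simp at hk hk'; omega
      simp [Nat.choose_eq_zero_of_lt this]
  rw [h1, Finset.sum_Ico_eq_sum_range]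
  have h2 := add_pow (X : ℝ[X]) (1 - X) (N - d)
  rw [add_sub_cancel, one_pow] at h2
  rw [← mul_one (C (N.choose d : ℝ) * X ^ d)]
  conv_rhs => rw [h2, Finset.mul_sum]
  refine Finset.sum_congr (by congr 1; omega) fun k hk => ?_
  have hk' : d + k ≤ N := by simp at hk; omega
  have e : (d + k).choose d * N.choose (d + k) = N.choose d * (N - d).choose k := by
    have := Nat.choose_mul (n := N) (Nat.le_add_right d k)
    rw [mul_comm, this, Nat.add_sub_cancel_left]
  rw [e, pow_add, Nat.cast_mul, C_mul, show N - (d + k) = N - d - k by omega]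
  simp only [map_natCast]
  ring

/-- The discrete measures approximating the solution of the Hausdorff moment problem. -/
noncomputable def bernsteinMeasure (c : ℕ → ℝ) (N : ℕ) : Measure I :=
  ∑ k ∈ Finset.range (N + 1), ENNReal.ofReal
    (N.choose k * momentFunctional c (X ^ k * (1 - X) ^ (N - k))) •
      Measure.dirac (Set.projIcc (0 : ℝ) 1 zero_le_one (k / N))

theorem integral_bernsteinMeasure {c : ℕ → ℝ} (hc : IsCMSeq c) (N d : ℕ) :
    ∫ x : I, (x : ℝ) ^ d ∂(bernsteinMeasure c N) = ∑ k ∈ Finset.range (N + 1),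
      N.choose k * momentFunctional c (X ^ k * (1 - X) ^ (N - k)) * ((k : ℝ) / N) ^ d := by
  rw [bernsteinMeasure, integral_finsetSum_measure]
  · refine Finset.sum_congr rfl fun k hk => ?_
    rw [integral_smul_measure, integral_dirac, ENNReal.toReal_ofReal, smul_eq_mul]
    · congr 2
      rw [Set.coe_projIcc]
      have h1 : (k : ℝ) / N ≤ 1 := by
        apply div_le_one_of_le₀ _ (by positivity)
        simp at hk; exact_mod_cast (by omega : k ≤ N)
      rw [min_eq_right h1, max_eq_right (by positivity)]
    · exact mul_nonneg (by positivity) (hc _ _)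
  · intro k _
    refine Integrable.smul_measure ?_ ENNReal.ofReal_ne_top
    exact integrable_dirac (by simp)

/-- The Bernstein weights reproduce `c d` exactly when powers of `k / N` are replaced by
falling-factorial ratios; only that replacement causes an error in the moments. -/
theorem sum_choose_mul_momentFunctional (c : ℕ → ℝ) (N d : ℕ) (hd : d ≤ N) :
    ∑ k ∈ Finset.range (N + 1), N.choose k * momentFunctional c (X ^ k * (1 - X) ^ (N - k)) *
      ((k.descFactorial d : ℝ) / N.descFactorial d) = c d := by
  have h := congrArg (momentFunctional c) (sum_choose_mul_choose_mul_pow N d hd)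
  rw [map_sum, momentFunctional_C_mul_X_pow] at h
  simp only [momentFunctional_C_mul] at h
  have hN : (N.choose d : ℝ) ≠ 0 := by exact_mod_cast (Nat.choose_pos hd).ne'
  have hd' : (d.factorial : ℝ) ≠ 0 := by exact_mod_cast d.factorial_ne_zero
  refine mul_right_cancel₀ hN ?_
  rw [← h, Finset.sum_mul]
  refine Finset.sum_congr rfl fun k _ => ?_
  rw [Nat.descFactorial_eq_factorial_mul_choose, Nat.descFactorial_eq_factorial_mul_choose]
  push_cast
  field_simp

theorem bernsteinMeasure_univ {c : ℕ → ℝ} (hc : IsCMSeq c) (N : ℕ) :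
    bernsteinMeasure c N Set.univ = ENNReal.ofReal (c 0) := by
  have h := sum_choose_mul_momentFunctional c N 0 (Nat.zero_le _)
  simp only [Nat.descFactorial_zero, Nat.cast_one, div_one, mul_one] at h
  simp only [bernsteinMeasure, Measure.coe_finsetSum, Finset.sum_apply, Measure.smul_apply,
    measure_univ, smul_eq_mul, mul_one]
  rw [← ENNReal.ofReal_sum_of_nonneg fun k _ => mul_nonneg (by positivity) (hc _ _), h]

theorem tendsto_integral_bernsteinMeasure {c : ℕ → ℝ} (hc : IsCMSeq c) (d : ℕ) :
    Tendsto (fun N => ∫ x : I, (x : ℝ) ^ d ∂(bernsteinMeasure c N)) atTop (𝓝 (c d)) := by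
  rw [tendsto_iff_norm_sub_tendsto_zero]
  have hlim : Tendsto (fun N : ℕ => c 0 * ((d : ℝ) ^ 2 / N)) atTop (𝓝 0) := by
    simpa using (tendsto_const_div_atTop_nhds_zero_nat ((d : ℝ) ^ 2)).const_mul (c 0)
  refine squeeze_zero' (Eventually.of_forall fun _ => norm_nonneg _) ?_ hlim
  filter_upwards [eventually_ge_atTop d] with N hN
  have h0 := sum_choose_mul_momentFunctional c N 0 (Nat.zero_le _)
  simp only [Nat.descFactorial_zero, Nat.cast_one, div_one, mul_one] at h0
  rw [integral_bernsteinMeasure hc, ← sum_choose_mul_momentFunctional c N d hN,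
    ← Finset.sum_sub_distrib, Real.norm_eq_abs, ← h0, Finset.sum_mul]
  refine (Finset.abs_sum_le_sum_abs _ _).trans (Finset.sum_le_sum fun k hk => ?_)
  have hw : 0 ≤ N.choose k * momentFunctional c (X ^ k * (1 - X) ^ (N - k)) :=
    mul_nonneg (by positivity) (hc _ _)
  rw [← mul_sub, abs_mul, abs_of_nonneg hw, abs_sub_comm]
  exact mul_le_mul_of_nonneg_left
    (abs_descFactorial_div_sub_pow_le (by simp at hk; omega) d hN) hw

theorem exists_measure_of_isCMSeq {c : ℕ → ℝ} (hc : IsCMSeq c) :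
    ∃ μ : Measure I, IsFiniteMeasure μ ∧ ∀ n, ∫ x : I, (x : ℝ) ^ n ∂μ = c n := by
  rcases (hc.nonneg 0).eq_or_lt with h0 | h0
  · refine ⟨0, inferInstance, fun n => ?_⟩
    have := hc.antitone (Nat.zero_le n)
    have := hc.nonneg n
    simp; linarith
  have hprob : ∀ N, IsProbabilityMeasure ((ENNReal.ofReal (c 0))⁻¹ • bernsteinMeasure c N) := by
    intro N
    constructor
    rw [Measure.smul_apply, bernsteinMeasure_univ hc, smul_eq_mul]
    exact ENNReal.inv_mul_cancel (by simpa using h0) ENNReal.ofReal_ne_top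
  let P : ℕ → ProbabilityMeasure I := fun N => ⟨_, hprob N⟩
  -- Probability measures on the compact interval form a compact space, so a limit along an
  -- ultrafilter exists without extracting a subsequence.
  obtain ⟨μ, hμ⟩ : ∃ μ : ProbabilityMeasure I, Tendsto P (hyperfilter ℕ) (𝓝 μ) :=
    ⟨_, ((hyperfilter ℕ).map P).le_nhds_lim⟩
  rw [ProbabilityMeasure.tendsto_iff_forall_integral_tendsto] at hμ
  refine ⟨ENNReal.ofReal (c 0) • (μ : Measure I), Measure.smul_finite _ ENNReal.ofReal_ne_top, fun n => ?_⟩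
  let f : BoundedContinuousFunction I ℝ :=
    BoundedContinuousFunction.mkOfCompact ⟨fun x : I => (x : ℝ) ^ n, by fun_prop⟩
  have h1 := hμ f
  have h2 := ((tendsto_integral_bernsteinMeasure hc n).const_mul (c 0)⁻¹).mono_left
    (Nat.hyperfilter_le_atTop)
  have h3 : ∀ N, ∫ x, f x ∂(P N : Measure I) =
      (c 0)⁻¹ * ∫ x : I, (x : ℝ) ^ n ∂(bernsteinMeasure c N) := by
    intro N
    change ∫ x : I, (x : ℝ) ^ n ∂((ENNReal.ofReal (c 0))⁻¹ • bernsteinMeasure c N) = _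
    rw [integral_smul_measure, ENNReal.toReal_inv, ENNReal.toReal_ofReal h0.le, smul_eq_mul]
  simp only [h3] at h1
  have h4 : ∫ x : I, (x : ℝ) ^ n ∂(μ : Measure I) = (c 0)⁻¹ * c n := tendsto_nhds_unique h1 h2
  rw [integral_smul_measure, ENNReal.toReal_ofReal h0.le, h4, smul_eq_mul,
    mul_inv_cancel_left₀ h0.ne']

theorem IsCMSeq.momentFunctional_nonneg {c : ℕ → ℝ} (hc : IsCMSeq c) (p : ℝ[X])
    (hp : ∀ x ∈ Set.Icc (0 : ℝ) 1, 0 ≤ p.eval x) : 0 ≤ momentFunctional c p := by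
  obtain ⟨μ, _, hμ⟩ := exists_measure_of_isCMSeq hc
  have key : ∀ p : ℝ[X], Integrable (fun x : I => p.eval (x : ℝ)) μ ∧
      ∫ x : I, p.eval (x : ℝ) ∂μ = momentFunctional c p := by
    intro p
    have hint : ∀ p : ℝ[X], Integrable (fun x : I => p.eval (x : ℝ)) μ := fun p =>
      BoundedContinuousFunction.integrable μ
        (BoundedContinuousFunction.mkOfCompact ⟨fun x : I => p.eval (x : ℝ), by fun_prop⟩)
    refine ⟨hint p, ?_⟩
    induction p using Polynomial.induction_on' with
    | add p q hp hq =>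
      simp only [eval_add]
      rw [integral_add (hint p) (hint q), hp, hq, map_add]
    | monomial n r =>
      simp only [eval_monomial]
      rw [integral_const_mul, hμ, momentFunctional_monomial, mul_comm]
  rw [← (key p).2]
  exact integral_nonneg fun x => hp x x.2

/-! ### Reciprocals -/

/-- Hankel congruence is applied to two reciprocal pairs: `c` with `(1 - X) a`, and `(1 - X) c` with
`a`. It turns positivity of `c` on `X p²` into that of `a` on `(1 - X) q²`, and conversely. -/
theorem IsCMSeq.inv {a : ℕ → ℝ} (ha : IsCMSeq a) {c : PowerSeries ℝ}
    (hc : c * ((1 - PowerSeries.X) * PowerSeries.mk a) = 1) :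
    IsCMSeq fun n => PowerSeries.coeff n c := by
  have hsucc : ∀ (b : PowerSeries ℝ) n, PowerSeries.coeff (n + 1) ((1 - PowerSeries.X) * b) =
      PowerSeries.coeff (n + 1) b - PowerSeries.coeff n b := by
    intro b n
    rw [sub_mul, one_mul, map_sub, PowerSeries.coeff_succ_X_mul]
  refine isCMSeq_of_forall_sq_nonneg (fun p => ?_) (fun p => ?_)
  · obtain ⟨q, hq⟩ := exists_momentFunctional_sq_eq_neg hc p
    rw [momentFunctional_X_mul, hq]
    simp only [hsucc, PowerSeries.coeff_mk]
    rw [momentFunctional_sub, ← momentFunctional_X_mul, neg_sub, ← map_sub]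
    refine ha.momentFunctional_nonneg _ fun x hx => ?_
    have : eval x (q * q - X * (q * q)) = (1 - x) * (eval x q * eval x q) := by
      simp; ring
    rw [this]
    exact mul_nonneg (by linarith [hx.2]) (mul_self_nonneg _)
  · have hc' : ((1 - PowerSeries.X) * c) * PowerSeries.mk a = 1 := by
      rw [mul_comm _ c, mul_assoc, hc]
    obtain ⟨q, hq⟩ := exists_momentFunctional_sq_eq_neg hc' p
    simp only [hsucc, PowerSeries.coeff_mk] at hq
    rw [momentFunctional_sub, ← momentFunctional_X_mul,
      ← momentFunctional_X_mul (fun n => PowerSeries.coeff n c)] at hq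
    rw [sub_mul, one_mul, map_sub]
    have : 0 ≤ momentFunctional a (X * (q * q)) := by
      refine ha.momentFunctional_nonneg _ fun x hx => ?_
      rw [eval_mul, eval_mul, eval_X]
      exact mul_nonneg hx.1 (mul_self_nonneg _)
    linarith

end Viscoelastic

namespace Viscoelastic

open MeasureTheory Filter Topology Set

/-! ### Estimates for completely monotonic functions -/

theorem IsCM.hasDerivAt_iteratedDeriv {G : ℝ → ℝ} (hG : IsCM G) (n : ℕ) {t : ℝ} (ht : 0 < t) :
    HasDerivAt (iteratedDeriv n G) (iteratedDeriv (n + 1) G t) t := by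
  have h1 : DifferentiableOn ℝ (iteratedDerivWithin n G (Ioi 0)) (Ioi 0) :=
    hG.1.differentiableOn_iteratedDerivWithin (by exact_mod_cast WithTop.coe_lt_top n)
      isOpen_Ioi.uniqueDiffOn
  have h2 : DifferentiableOn ℝ (iteratedDeriv n G) (Ioi 0) :=
    h1.congr fun x hx => (iteratedDerivWithin_of_isOpen isOpen_Ioi hx).symm
  rw [iteratedDeriv_succ]
  exact (h2.differentiableAt (Ioi_mem_nhds ht)).hasDerivAt

/-- The alternating derivatives `(-1)^n G^(n)`. -/
noncomputable def altDeriv (G : ℝ → ℝ) (n : ℕ) (t : ℝ) : ℝ := (-1) ^ n * iteratedDeriv n G t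

theorem altDeriv_zero (G : ℝ → ℝ) : altDeriv G 0 = G := by
  ext t; simp [altDeriv]

theorem IsCM.altDeriv_nonneg {G : ℝ → ℝ} (hG : IsCM G) (n : ℕ) {t : ℝ} (ht : 0 < t) :
    0 ≤ altDeriv G n t := hG.2 n t ht

theorem IsCM.hasDerivAt_altDeriv {G : ℝ → ℝ} (hG : IsCM G) (n : ℕ) {t : ℝ} (ht : 0 < t) :
    HasDerivAt (altDeriv G n) (-altDeriv G (n + 1) t) t := by
  refine ((hG.hasDerivAt_iteratedDeriv n ht).const_mul ((-1) ^ n)).congr_deriv ?_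
  simp only [altDeriv, pow_succ]; ring

theorem IsCM.continuousOn_altDeriv {G : ℝ → ℝ} (hG : IsCM G) (n : ℕ) :
    ContinuousOn (altDeriv G n) (Ioi 0) := fun _ ht =>
  (hG.hasDerivAt_altDeriv n ht).continuousAt.continuousWithinAt

theorem IsCM.antitoneOn_altDeriv {G : ℝ → ℝ} (hG : IsCM G) (n : ℕ) :
    AntitoneOn (altDeriv G n) (Ioi 0) := by
  refine antitoneOn_of_deriv_nonpos (convex_Ioi 0) (hG.continuousOn_altDeriv n) ?_ ?_
  · rw [interior_Ioi]
    exact fun t ht => (hG.hasDerivAt_altDeriv n ht).differentiableAt.differentiableWithinAt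
  · rw [interior_Ioi]
    intro t ht
    rw [(hG.hasDerivAt_altDeriv n ht).deriv, neg_nonpos]
    exact hG.altDeriv_nonneg _ ht

theorem IsCM.nonneg {G : ℝ → ℝ} (hG : IsCM G) {t : ℝ} (ht : 0 < t) : 0 ≤ G t := by
  simpa [altDeriv_zero] using hG.altDeriv_nonneg 0 ht

theorem IsCM.antitoneOn {G : ℝ → ℝ} (hG : IsCM G) : AntitoneOn G (Ioi 0) := by
  simpa [altDeriv_zero] using hG.antitoneOn_altDeriv 0

theorem IsCM.continuousOn {G : ℝ → ℝ} (hG : IsCM G) : ContinuousOn G (Ioi 0) := by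
  simpa [altDeriv_zero] using hG.continuousOn_altDeriv 0

/-- Mean value theorem on `[t / 2, t]`, where the next alternating derivative is at least its value
at `t`. Iterated, this bounds every derivative by `G` itself, which controls integrability and
boundary terms near `0`. -/
theorem IsCM.mul_altDeriv_succ_le {G : ℝ → ℝ} (hG : IsCM G) (n : ℕ) {t : ℝ} (ht : 0 < t) :
    t * altDeriv G (n + 1) t ≤ 2 * altDeriv G n (t / 2) := by
  have ht2 : t / 2 < t := by linarith
  obtain ⟨x, hx, hxe⟩ := exists_hasDerivAt_eq_slope (altDeriv G n)
    (fun t => -altDeriv G (n + 1) t) ht2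
    ((hG.continuousOn_altDeriv n).mono fun x hx => by
      have := hx.1; simp only [mem_Ioi]; linarith)
    (fun x hx => hG.hasDerivAt_altDeriv n (by have := hx.1; linarith))
  have h1 := hG.antitoneOn_altDeriv (n + 1) (a := x) (b := t)
    (by have := hx.1; simp only [mem_Ioi]; linarith) ht hx.2.le
  have h2 := hG.altDeriv_nonneg n ht
  rw [eq_div_iff (by linarith)] at hxe
  nlinarith

theorem IsCM.exists_pow_mul_altDeriv_le {G : ℝ → ℝ} (hG : IsCM G) (n : ℕ) :
    ∃ K : ℝ, 0 ≤ K ∧ ∀ t : ℝ, 0 < t → t ^ n * altDeriv G n t ≤ K * G (t / 2 ^ n) := by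
  induction n with
  | zero => exact ⟨1, zero_le_one, fun t _ => by simp [altDeriv_zero]⟩
  | succ n ih =>
    obtain ⟨K, hK, h⟩ := ih
    refine ⟨2 ^ (n + 1) * K, by positivity, fun t ht => ?_⟩
    calc t ^ (n + 1) * altDeriv G (n + 1) t = t ^ n * (t * altDeriv G (n + 1) t) := by ring
      _ ≤ t ^ n * (2 * altDeriv G n (t / 2)) :=
        mul_le_mul_of_nonneg_left (hG.mul_altDeriv_succ_le n ht) (by positivity)
      _ = 2 ^ (n + 1) * ((t / 2) ^ n * altDeriv G n (t / 2)) := by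
        rw [div_pow]; field_simp; ring
      _ ≤ 2 ^ (n + 1) * (K * G (t / 2 / 2 ^ n)) := by
        exact mul_le_mul_of_nonneg_left (h _ (by linarith)) (by positivity)
      _ = _ := by rw [mul_assoc, div_div, pow_succ' 2 n]

theorem IsLICM.integrableOn_Icc {G : ℝ → ℝ} (hG : IsLICM G) (b : ℝ) :
    IntegrableOn G (Icc 0 b) :=
  hG.2.integrableOn_compact_subset Icc_subset_Ici_self isCompact_Icc

theorem IsLICM.integrableOn_exp_mul {G : ℝ → ℝ} (hG : IsLICM G) {b : ℝ} (hb : 0 < b) :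
    IntegrableOn (fun t => Real.exp (-b * t) * G t) (Ioi 0) := by
  rw [← Ioc_union_Ioi_eq_Ioi zero_le_one]
  refine IntegrableOn.union ?_ ?_
  · refine Integrable.bdd_mul (c := 1) ((hG.integrableOn_Icc 1).mono_set Ioc_subset_Icc_self)
      (by fun_prop) ?_
    filter_upwards [ae_restrict_mem measurableSet_Ioc] with t ht
    rw [Real.norm_eq_abs, Real.abs_exp, Real.exp_le_one_iff]
    nlinarith [ht.1]
  · refine ((exp_neg_integrableOn_Ioi 1 hb).mul_const (G 1)).mono' ?_ ?_
    · refine ContinuousOn.aestronglyMeasurable ?_ measurableSet_Ioi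
      refine ContinuousOn.mul (by fun_prop) (hG.1.continuousOn.mono fun t ht => ?_)
      exact zero_lt_one.trans (mem_Ioi.1 ht)
    · filter_upwards [ae_restrict_mem measurableSet_Ioi] with t ht
      have ht0 : 0 < t := zero_lt_one.trans (mem_Ioi.1 ht)
      rw [norm_mul, Real.norm_eq_abs, Real.abs_exp, Real.norm_eq_abs, abs_of_nonneg (hG.1.nonneg ht0)]
      gcongr
      exact hG.1.antitoneOn (mem_Ioi.2 zero_lt_one) ht0 (le_of_lt ht)

/-- Monotonicity gives `t * G t ≤ ∫_0^t G`, and the integral tends to `0` by local integrability. -/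
theorem IsLICM.tendsto_mul_zero {G : ℝ → ℝ} (hG : IsLICM G) :
    Tendsto (fun t => t * G t) (𝓝[>] 0) (𝓝 0) := by
  have hint : ∀ b, 0 ≤ b → IntervalIntegrable G volume 0 b := fun b hb => by
    rw [intervalIntegrable_iff_integrableOn_Icc_of_le hb]; exact hG.integrableOn_Icc b
  have hlim : Tendsto (fun t => ∫ x in (0 : ℝ)..t, G x) (𝓝[>] 0) (𝓝 0) := by
    have h := intervalIntegral.continuousWithinAt_primitive (a := 0) (b₀ := 0) (b₁ := 0) (b₂ := 1)
      (f := G) (μ := volume) (by simp) (by simpa using hint 1 zero_le_one)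
    have h' := h.tendsto
    rw [intervalIntegral.integral_same] at h'
    exact h'.mono_left (nhdsWithin_le_of_mem (Icc_mem_nhdsGT zero_lt_one))
  refine squeeze_zero' ?_ ?_ hlim
  · filter_upwards [self_mem_nhdsWithin] with t ht using mul_nonneg (le_of_lt ht) (hG.1.nonneg ht)
  · filter_upwards [self_mem_nhdsWithin] with t ht
    have := intervalIntegral.integral_mono_on_of_le_Ioo (a := 0) (b := t) (f := fun _ => G t)
      (g := G) (μ := volume) (le_of_lt ht) (by simp) (hint t (le_of_lt ht))
      (fun x hx => hG.1.antitoneOn hx.1 ht hx.2.le)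
    simpa using this

/-! ### The moment sequence of the Laplace transform at `p = 1` -/

/-- The integrand `t^n / n! e^{-t} (-1)^m G^(m)(t)`. -/
noncomputable def gammaIntegrand (G : ℝ → ℝ) (n m : ℕ) (t : ℝ) : ℝ :=
  t ^ n / n.factorial * Real.exp (-t) * altDeriv G m t

theorem gammaIntegrand_nonneg {G : ℝ → ℝ} (hG : IsCM G) (n m : ℕ) {t : ℝ} (ht : 0 < t) :
    0 ≤ gammaIntegrand G n m t :=
  mul_nonneg (by positivity) (hG.altDeriv_nonneg m ht)

theorem pow_le_factorial_mul_exp_half {t : ℝ} (ht : 0 ≤ t) (n : ℕ) :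
    t ^ n ≤ 2 ^ n * n.factorial * Real.exp (t / 2) := by
  have h := Real.pow_div_factorial_le_exp (x := t / 2) (by linarith) n
  rw [div_le_iff₀ (by positivity), div_pow, div_le_iff₀ (by positivity)] at h
  linarith

/-- The factor `t^m` absorbs the `m` derivatives, whence `m ≤ n`; the remaining `t^(n - m)` is
absorbed by half of the exponential decay. -/
theorem integrableOn_gammaIntegrand {G : ℝ → ℝ} (hG : IsLICM G) {n m : ℕ} (hnm : m ≤ n) :
    IntegrableOn (gammaIntegrand G n m) (Ioi 0) := by
  obtain ⟨K, hK, hle⟩ := hG.1.exists_pow_mul_altDeriv_le m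
  have h1 : IntegrableOn (fun t => Real.exp (-(1 / 2) * t) * G (t / 2 ^ m)) (Ioi 0) := by
    have := (integrableOn_Ioi_comp_mul_left_iff
      (fun t => Real.exp (-(2 ^ m / 2) * t) * G t) 0 (a := 1 / 2 ^ m) (by positivity)).2
      (by simpa using hG.integrableOn_exp_mul (b := 2 ^ m / 2) (by positivity))
    refine this.congr_fun (fun t _ => ?_) measurableSet_Ioi
    simp only
    congr 2
    · field_simp
    · ring
  refine (h1.const_mul (2 ^ (n - m) * (n - m).factorial / n.factorial * K)).mono' ?_ ?_
  · refine ContinuousOn.aestronglyMeasurable ?_ measurableSet_Ioi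
    exact ContinuousOn.mul (by fun_prop) (hG.1.continuousOn_altDeriv m)
  · filter_upwards [ae_restrict_mem measurableSet_Ioi] with t ht
    have ht' : 0 < t := ht
    rw [Real.norm_eq_abs, abs_of_nonneg (gammaIntegrand_nonneg hG.1 n m ht), gammaIntegrand]
    have hGn : 0 ≤ G (t / 2 ^ m) := hG.1.nonneg (by positivity)
    have e : t ^ n = t ^ (n - m) * t ^ m := by rw [← pow_add]; congr 1; omega
    calc t ^ n / n.factorial * Real.exp (-t) * altDeriv G m t
        = t ^ (n - m) * Real.exp (-t) / n.factorial * (t ^ m * altDeriv G m t) := by rw [e]; ring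
      _ ≤ (2 ^ (n - m) * (n - m).factorial * Real.exp (t / 2)) * Real.exp (-t) / n.factorial *
          (K * G (t / 2 ^ m)) := by
        refine mul_le_mul ?_ (hle t ht') ?_ (by positivity)
        · gcongr
          exact pow_le_factorial_mul_exp_half ht'.le _
        · exact mul_nonneg (by positivity) (hG.1.altDeriv_nonneg m ht')
      _ = _ := by
        rw [mul_assoc _ (Real.exp (t / 2)), ← Real.exp_add]
        ring_nf

/-- Integration by parts: differentiating `t^(n+1) / (n+1)! e^{-t}` produces the difference of two
consecutive gamma weights. The boundary term at `0` vanishes because `t * G t → 0`. -/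
theorem integral_gammaIntegrand_succ {G : ℝ → ℝ} (hG : IsLICM G) {n m : ℕ} (hnm : m ≤ n) :
    ∫ t in Ioi 0, gammaIntegrand G (n + 1) (m + 1) t =
      (∫ t in Ioi 0, gammaIntegrand G n m t) - ∫ t in Ioi 0, gammaIntegrand G (n + 1) m t := by
  have i1 := integrableOn_gammaIntegrand hG hnm
  have i2 := integrableOn_gammaIntegrand hG (hnm.trans n.le_succ)
  have i3 := integrableOn_gammaIntegrand hG (Nat.succ_le_succ hnm)
  let u : ℝ → ℝ := fun t => t ^ (n + 1) / (n + 1).factorial * Real.exp (-t)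
  let u' : ℝ → ℝ := fun t => t ^ n / n.factorial * Real.exp (-t) -
    t ^ (n + 1) / (n + 1).factorial * Real.exp (-t)
  have hu : ∀ t ∈ Ioi (0 : ℝ), HasDerivAt u (u' t) t := by
    intro t _
    have h1 : HasDerivAt (fun t : ℝ => t ^ (n + 1) / ((n + 1).factorial : ℝ))
        (t ^ n / n.factorial) t := by
      refine ((hasDerivAt_pow (n + 1) t).div_const ((n + 1).factorial : ℝ)).congr_deriv ?_
      rw [Nat.factorial_succ]; push_cast; field_simp
    have h2 : HasDerivAt (fun t : ℝ => Real.exp (-t)) (-Real.exp (-t)) t := by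
      simpa using (hasDerivAt_neg t).exp
    refine (h1.mul h2).congr_deriv ?_
    simp only [u']; ring
  have hv : ∀ t ∈ Ioi (0 : ℝ), HasDerivAt (altDeriv G m) (-altDeriv G (m + 1) t) t :=
    fun t ht => hG.1.hasDerivAt_altDeriv m ht
  have e : ∀ t, u' t * altDeriv G m t + u t * -altDeriv G (m + 1) t =
      gammaIntegrand G n m t - gammaIntegrand G (n + 1) m t -
        gammaIntegrand G (n + 1) (m + 1) t := by
    intro t; simp only [u, u', gammaIntegrand]; ring
  have hzero : Tendsto (u * altDeriv G m) (𝓝[>] 0) (𝓝 0) := by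
    obtain ⟨K, hK, hle⟩ := hG.1.exists_pow_mul_altDeriv_le m
    have hsc : Tendsto (fun t : ℝ => t / 2 ^ m) (𝓝[>] 0) (𝓝[>] 0) := by
      refine tendsto_nhdsWithin_iff.2 ⟨?_, ?_⟩
      · have : Tendsto (fun t : ℝ => t / 2 ^ m) (𝓝 0) (𝓝 (0 / 2 ^ m)) :=
          tendsto_id.div_const _
        rw [zero_div] at this
        exact this.mono_left nhdsWithin_le_nhds
      · filter_upwards [self_mem_nhdsWithin] with t ht
        exact div_pos (mem_Ioi.1 ht) (by positivity : (0 : ℝ) < 2 ^ m)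
    have hlim := (hG.tendsto_mul_zero.comp hsc).const_mul (2 ^ m * K)
    rw [mul_zero] at hlim
    refine squeeze_zero' ?_ ?_ hlim
    · filter_upwards [self_mem_nhdsWithin] with t ht
      exact gammaIntegrand_nonneg hG.1 (n + 1) m ht
    · filter_upwards [Ioc_mem_nhdsGT zero_lt_one] with t ht
      have ht0 : 0 < t := ht.1
      have hGn : 0 ≤ G (t / 2 ^ m) := hG.1.nonneg (by positivity)
      have hd := hG.1.altDeriv_nonneg m ht0
      have hf : (1 : ℝ) ≤ (n + 1).factorial := by exact_mod_cast Nat.factorial_pos _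
      have e2 : t ^ (n + 1) = t ^ (n - m) * t * t ^ m := by
        rw [mul_assoc, ← pow_succ', ← pow_add]; congr 1; omega
      calc u t * altDeriv G m t ≤ t ^ (n + 1) / 1 * 1 * altDeriv G m t := by
            simp only [u]
            gcongr
            rw [Real.exp_le_one_iff]; linarith
        _ = t ^ (n - m) * t * (t ^ m * altDeriv G m t) := by rw [e2]; ring
        _ ≤ 1 * t * (K * G (t / 2 ^ m)) := by
            refine mul_le_mul ?_ (hle t ht0) (by positivity) (by positivity)
            gcongr
            exact pow_le_one₀ ht0.le ht.2
        _ = _ := by simp only [Function.comp]; field_simp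
  have hinf : Tendsto (u * altDeriv G m) atTop (𝓝 0) := by
    have hlim := ((Real.tendsto_pow_mul_exp_neg_atTop_nhds_zero (n + 1)).div_const
      ((n + 1).factorial : ℝ)).mul_const (altDeriv G m 1)
    rw [zero_div, zero_mul] at hlim
    refine squeeze_zero' ?_ ?_ hlim
    · filter_upwards [eventually_gt_atTop 0] with t ht
      exact gammaIntegrand_nonneg hG.1 (n + 1) m ht
    · filter_upwards [eventually_ge_atTop 1] with t ht
      have ht0 : 0 < t := zero_lt_one.trans_le ht
      have := hG.1.antitoneOn_altDeriv m (mem_Ioi.2 zero_lt_one) (mem_Ioi.2 ht0) ht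
      calc u t * altDeriv G m t ≤ u t * altDeriv G m 1 := by
            have : 0 ≤ u t := by simp only [u]; positivity
            gcongr
        _ = _ := by simp only [u]; ring
  have h := integral_Ioi_deriv_mul_eq_sub hu hv ?_ hzero hinf
  · simp only [e] at h
    have h12 := integral_sub i1 i2
    have h3 := integral_sub (i1.sub i2) i3
    simp only [Pi.sub_apply] at h3
    rw [h3, h12] at h
    linarith
  · refine IntegrableOn.congr_fun ((i1.sub i2).sub i3) (fun t _ => (e t).symm) measurableSet_Ioi

/-- The coefficients of the expansion of the Laplace transform of `G` in powers of `1 - p`. -/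
noncomputable def laplaceCoeff (G : ℝ → ℝ) (n : ℕ) : ℝ :=
  ∫ t in Ioi 0, gammaIntegrand G n 0 t

open Polynomial in
-- Each factor `1 - X` becomes one more alternating derivative under the integral, so the iterated
-- differences are integrals of nonnegative functions.
theorem isCMSeq_laplaceCoeff {G : ℝ → ℝ} (hG : IsLICM G) : IsCMSeq (laplaceCoeff G) := by
  have key : ∀ m k, momentFunctional (laplaceCoeff G) (X ^ k * (1 - X) ^ m) =
      ∫ t in Ioi 0, gammaIntegrand G (k + m) m t := by
    intro m
    induction m with
    | zero => intro k; simp [momentFunctional_X_pow, laplaceCoeff]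
    | succ m ih =>
      intro k
      have : (X ^ k * (1 - X) ^ (m + 1) : ℝ[X]) =
          X ^ k * (1 - X) ^ m - X ^ (k + 1) * (1 - X) ^ m := by ring
      rw [this, map_sub, ih, ih, ← add_assoc, integral_gammaIntegrand_succ hG (Nat.le_add_left m k),
        add_right_comm]
  intro k m
  rw [key]
  exact setIntegral_nonneg measurableSet_Ioi fun t ht => gammaIntegrand_nonneg hG.1 _ _ ht

/-- Expand `e^{-pt} = e^{-t} ∑ (t (1 - p))^n / n!`. For `p ≤ 1` all terms are nonnegative, so
termwise integration only needs the geometric bound. -/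
theorem hasSum_laplaceCoeff {G : ℝ → ℝ} (hG : IsLICM G) {p : ℝ} (hp : p ∈ Ioc (0 : ℝ) 1) :
    HasSum (fun n => laplaceCoeff G n * (1 - p) ^ n) (∫ t in Ioi 0, Real.exp (-p * t) * G t) := by
  have hz : 0 ≤ 1 - p := by linarith [hp.2]
  have hz1 : 1 - p < 1 := by linarith [hp.1]
  have hcm := isCMSeq_laplaceCoeff hG
  have hpos : ∀ n, ∀ t ∈ Ioi (0 : ℝ), 0 ≤ gammaIntegrand G n 0 t * (1 - p) ^ n := fun n t ht =>
    mul_nonneg (gammaIntegrand_nonneg hG.1 n 0 ht) (by positivity)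
  have h := hasSum_integral_of_summable_integral_norm (μ := volume.restrict (Ioi 0))
    (F := fun n t => gammaIntegrand G n 0 t * (1 - p) ^ n)
    (fun n => (integrableOn_gammaIntegrand hG (Nat.zero_le n)).mul_const _) ?_
  · simp only [integral_mul_const] at h
    suffices e : ∫ t in Ioi 0, Real.exp (-p * t) * G t =
        ∫ t in Ioi 0, ∑' n, gammaIntegrand G n 0 t * (1 - p) ^ n by rw [e]; exact h
    refine setIntegral_congr_fun measurableSet_Ioi fun t _ => ?_
    have h1 := (NormedSpace.expSeries_div_hasSum_exp (𝔸 := ℝ) (t * (1 - p))).mul_right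
      (Real.exp (-t) * G t)
    rw [← Real.exp_eq_exp_ℝ] at h1
    symm
    convert h1.tsum_eq using 1
    · refine tsum_congr fun n => ?_
      rw [gammaIntegrand, altDeriv_zero, mul_pow]; ring
    · rw [← mul_assoc, ← Real.exp_add]; congr 2; ring
  · refine Summable.of_nonneg_of_le (fun n => integral_nonneg fun t => norm_nonneg _) (fun n => ?_)
      ((summable_geometric_of_lt_one hz hz1).mul_left (laplaceCoeff G 0))
    have e : ∫ t in Ioi 0, ‖gammaIntegrand G n 0 t * (1 - p) ^ n‖ =
        ∫ t in Ioi 0, gammaIntegrand G n 0 t * (1 - p) ^ n :=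
      setIntegral_congr_fun measurableSet_Ioi fun t ht => Real.norm_of_nonneg (hpos n t ht)
    rw [e, integral_mul_const]
    exact mul_le_mul_of_nonneg_right (hcm.antitone (Nat.zero_le n)) (by positivity)

/-! ### The Laplace transform on the right half-plane -/

theorem laplace_ofReal (G : ℝ → ℝ) (p : ℝ) :
    laplace G p = ((∫ t in Ioi 0, Real.exp (-p * t) * G t : ℝ) : ℂ) := by
  rw [laplace, ← integral_complex_ofReal]
  congr 1; ext t; push_cast; rfl

theorem differentiableAt_laplace {G : ℝ → ℝ} (hG : IsLICM G) {p : ℂ} (hp : 0 < p.re) :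
    DifferentiableAt ℂ (laplace G) p := by
  have hmeas : ∀ f : ℝ → ℂ, Continuous f →
      AEStronglyMeasurable (fun t => f t * (G t : ℂ)) (volume.restrict (Ioi 0)) := fun f hf =>
    (hf.continuousOn.mul (Complex.continuous_ofReal.comp_continuousOn
      hG.1.continuousOn)).aestronglyMeasurable measurableSet_Ioi
  have hopen : {q : ℂ | p.re / 2 < q.re} ∈ 𝓝 p :=
    (isOpen_lt continuous_const Complex.continuous_re).mem_nhds (by simp; linarith)
  refine (hasDerivAt_integral_of_dominated_loc_of_deriv_le (μ := volume.restrict (Ioi 0))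
    (F := fun (q : ℂ) (t : ℝ) => Complex.exp (-q * t) * (G t : ℂ))
    (F' := fun (q : ℂ) (t : ℝ) => (Complex.exp (-q * t) * (-t)) * (G t : ℂ))
    (bound := fun t => 4 / p.re * (Real.exp (-(p.re / 4) * t) * G t))
    hopen ?_ ?_ ?_ ?_ ?_ ?_).2.differentiableAt
  · exact Eventually.of_forall fun q => hmeas _ (by fun_prop)
  · refine Integrable.mono (hG.integrableOn_exp_mul hp) (hmeas (fun t => Complex.exp (-p * t)) (by fun_prop)) ?_
    refine Eventually.of_forall fun t => ?_
    rw [norm_mul, norm_mul, Complex.norm_exp, Complex.norm_real, Real.norm_eq_abs (Real.exp _),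
      Real.abs_exp]
    simp
  · exact hmeas (fun t => Complex.exp (-p * t) * (-t)) (by fun_prop)
  · filter_upwards [ae_restrict_mem measurableSet_Ioi] with t ht q hq
    have ht0 : 0 < t := ht
    have hq' : p.re / 2 < q.re := hq
    have h1 := Real.add_one_le_exp (p.re / 4 * t)
    rw [norm_mul, norm_mul, Complex.norm_exp, Complex.norm_real, norm_neg, Complex.norm_real,
      Real.norm_of_nonneg ht0.le, Real.norm_of_nonneg (hG.1.nonneg ht0), ← mul_assoc]
    refine mul_le_mul_of_nonneg_right ?_ (hG.1.nonneg ht0)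
    have h2 : (-q * (t : ℂ)).re = -q.re * t := by simp
    rw [h2]
    -- Half of the decay rate `p.re / 2` is spent on the factor `t`.
    calc Real.exp (-q.re * t) * t ≤ Real.exp (-(p.re / 2) * t) * (4 / p.re * Real.exp (p.re / 4 * t)) := by
          gcongr
          rw [div_mul_eq_mul_div, le_div_iff₀ hp]; linarith
      _ = 4 / p.re * (Real.exp (-(p.re / 2) * t) * Real.exp (p.re / 4 * t)) := by ring
      _ = _ := by rw [← Real.exp_add]; congr 2; ring
  · exact (hG.integrableOn_exp_mul (by positivity)).const_mul _
  · refine Eventually.of_forall fun t q _ => ?_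
    have h1 : HasDerivAt (fun q : ℂ => -q * (t : ℂ)) (-(t : ℂ)) q := by
      simpa using (hasDerivAt_neg q).mul_const (t : ℂ)
    exact h1.cexp.mul_const _

end Viscoelastic

namespace Viscoelastic

open MeasureTheory Filter Topology Set

/-! ### Reciprocal square roots -/

theorem hasSum_coeff_mul_mul_pow {f g : PowerSeries ℝ} {z F H : ℝ} (hz : 0 ≤ z)
    (hf : Summable fun n => |PowerSeries.coeff n f| * z ^ n)
    (hF : HasSum (fun n => PowerSeries.coeff n f * z ^ n) F)
    (hg : Summable fun n => |PowerSeries.coeff n g| * z ^ n)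
    (hH : HasSum (fun n => PowerSeries.coeff n g * z ^ n) H) :
    HasSum (fun n => PowerSeries.coeff n (f * g) * z ^ n) (F * H) := by
  have e : ∀ h : PowerSeries ℝ, (fun n => |PowerSeries.coeff n h| * z ^ n) =
      fun n => ‖PowerSeries.coeff n h * z ^ n‖ := by
    intro h; ext n; rw [norm_mul, Real.norm_eq_abs, Real.norm_of_nonneg (by positivity)]
  rw [e] at hf hg
  have h := (summable_norm_sum_mul_antidiagonal_of_summable_norm hf hg).of_norm.hasSum
  rw [← tsum_mul_tsum_eq_tsum_sum_antidiagonal_of_summable_norm hf hg, hF.tsum_eq, hH.tsum_eq] at h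
  suffices e' : (fun n => PowerSeries.coeff n (f * g) * z ^ n) = fun n =>
      ∑ kl ∈ Finset.HasAntidiagonal.antidiagonal n, PowerSeries.coeff kl.1 f * z ^ kl.1 *
        (PowerSeries.coeff kl.2 g * z ^ kl.2) by rw [e']; exact h
  ext n
  rw [PowerSeries.coeff_mul, Finset.sum_mul]
  refine Finset.sum_congr rfl fun x hx => ?_
  rw [← Finset.HasAntidiagonal.mem_antidiagonal.1 hx, pow_add]; ring

theorem IsCMSeq.summable_mul_pow {c : ℕ → ℝ} (hc : IsCMSeq c) {z : ℝ} (hz : z ∈ Ico (0 : ℝ) 1) :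
    Summable fun n => c n * z ^ n :=
  Summable.of_nonneg_of_le (fun n => mul_nonneg (hc.nonneg n) (pow_nonneg hz.1 n))
    (fun n => mul_le_mul_of_nonneg_right (hc.antitone (Nat.zero_le n)) (pow_nonneg hz.1 n))
    ((summable_geometric_of_lt_one hz.1 hz.2).mul_left (c 0))

/-- The power series of `1 / (E + s)` with `E = (1 - X) ∑ a_n X^n`. -/
noncomputable def resolventSeries (a : ℕ → ℝ) (s : ℝ) : PowerSeries ℝ :=
  ((1 - PowerSeries.X) * PowerSeries.mk fun n => a n + s)⁻¹

theorem resolventSeries_mul {a : ℕ → ℝ} {s : ℝ} (h : a 0 + s ≠ 0) :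
    resolventSeries a s * ((1 - PowerSeries.X) * PowerSeries.mk fun n => a n + s) = 1 :=
  PowerSeries.inv_mul_cancel _ (by simpa using h)

theorem coeff_zero_resolventSeries (a : ℕ → ℝ) (s : ℝ) :
    PowerSeries.coeff 0 (resolventSeries a s) = (a 0 + s)⁻¹ := by
  rw [resolventSeries, PowerSeries.coeff_inv]; simp

theorem isCMSeq_resolventSeries {a : ℕ → ℝ} (ha : IsCMSeq a) (h0 : 0 < a 0) {s : ℝ} (hs : 0 ≤ s) :
    IsCMSeq fun n => PowerSeries.coeff n (resolventSeries a s) :=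
  (ha.add_const hs).inv (resolventSeries_mul (by positivity))

/-- Strong induction along the recursion for the coefficients of an inverse power series. -/
theorem measurable_coeff_resolventSeries (a : ℕ → ℝ) (n : ℕ) :
    Measurable fun s => PowerSeries.coeff n (resolventSeries a s) := by
  have hφ : ∀ n, Measurable fun s : ℝ => PowerSeries.coeff n
      ((1 - PowerSeries.X) * PowerSeries.mk fun n => a n + s) := by
    intro n
    simp only [PowerSeries.coeff_mul, PowerSeries.coeff_mk]
    fun_prop
  have hφ0 : Measurable fun s : ℝ => (PowerSeries.constantCoeff
      ((1 - PowerSeries.X) * PowerSeries.mk fun n => a n + s))⁻¹ := by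
    have := (hφ 0).fun_inv
    simpa only [PowerSeries.coeff_zero_eq_constantCoeff] using this
  induction n using Nat.strong_induction_on with
  | _ n ih =>
    have e : (fun s => PowerSeries.coeff n (resolventSeries a s)) = fun s => if n = 0 then
        (PowerSeries.constantCoeff ((1 - PowerSeries.X) * PowerSeries.mk fun n => a n + s))⁻¹
        else -(PowerSeries.constantCoeff
          ((1 - PowerSeries.X) * PowerSeries.mk fun n => a n + s))⁻¹ *
          ∑ x ∈ Finset.HasAntidiagonal.antidiagonal n, if x.2 < n then PowerSeries.coeff x.1
            ((1 - PowerSeries.X) * PowerSeries.mk fun n => a n + s) *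
            PowerSeries.coeff x.2 (resolventSeries a s) else 0 := by
      ext s; rw [resolventSeries, PowerSeries.coeff_inv]
    rw [e]
    split_ifs with hn
    · exact hφ0
    · refine hφ0.neg.mul (Finset.measurable_fun_sum _ fun x _ => ?_)
      split_ifs with hx
      · exact (hφ _).mul (ih _ hx)
      · exact measurable_const

theorem hasSum_resolventSeries {a : ℕ → ℝ} (ha : IsCMSeq a) (h0 : 0 < a 0) {s : ℝ} (hs : 0 ≤ s)
    {z A : ℝ} (hz : z ∈ Ico (0 : ℝ) 1) (hA : HasSum (fun n => a n * z ^ n) A) :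
    HasSum (fun n => PowerSeries.coeff n (resolventSeries a s) * z ^ n)
      ((1 - z) * A + s)⁻¹ := by
  have hz1 : 0 < 1 - z := by linarith [hz.2]
  have hA0 : 0 < A := by
    have := le_hasSum hA 0 fun n _ => mul_nonneg (ha.nonneg n) (pow_nonneg hz.1 n)
    simp at this; linarith
  have hc := isCMSeq_resolventSeries ha h0 hs
  have has := ha.add_const hs
  have hX : HasSum (fun n => PowerSeries.coeff n (1 - PowerSeries.X : PowerSeries ℝ) * z ^ n)
      (1 - z) := by
    have := hasSum_sum_of_ne_finset_zero (s := Finset.range 2) (L := .unconditional ℕ)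
      (f := fun n => PowerSeries.coeff n (1 - PowerSeries.X : PowerSeries ℝ) * z ^ n) (by
        intro n hn
        have h1 : n ≠ 0 := by rintro rfl; simp at hn
        have h2 : n ≠ 1 := by rintro rfl; simp at hn
        simp [PowerSeries.coeff_one, PowerSeries.coeff_X, h1, h2])
    simpa [Finset.sum_range_succ, PowerSeries.coeff_one, PowerSeries.coeff_X,
      ← sub_eq_add_neg] using this
  have hXs : Summable fun n => |PowerSeries.coeff n (1 - PowerSeries.X : PowerSeries ℝ)| * z ^ n := by
    refine summable_of_ne_finset_zero (s := Finset.range 2) ?_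
    intro n hn
    have h1 : n ≠ 0 := by rintro rfl; simp at hn
    have h2 : n ≠ 1 := by rintro rfl; simp at hn
    simp [PowerSeries.coeff_one, PowerSeries.coeff_X, h1, h2]
  have hB : HasSum (fun n => PowerSeries.coeff n (PowerSeries.mk fun n => a n + s) * z ^ n)
      (A + s * (1 - z)⁻¹) := by
    simp only [PowerSeries.coeff_mk, add_mul]
    exact hA.add ((hasSum_geometric_of_lt_one hz.1 hz.2).mul_left s)
  have hBs : Summable fun n => |PowerSeries.coeff n (PowerSeries.mk fun n => a n + s)| * z ^ n := by
    simp only [PowerSeries.coeff_mk, abs_of_nonneg (has.nonneg _)]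
    exact has.summable_mul_pow hz
  have hE := hasSum_coeff_mul_mul_pow hz.1 hXs hX hBs hB
  have hEs : Summable fun n => |PowerSeries.coeff n
      ((1 - PowerSeries.X) * PowerSeries.mk fun n => a n + s)| * z ^ n := by
    have := hE.summable.norm
    simpa only [norm_mul, Real.norm_eq_abs, abs_of_nonneg (pow_nonneg hz.1 _)] using this
  have hcs : Summable fun n => |PowerSeries.coeff n (resolventSeries a s)| * z ^ n := by
    simp only [abs_of_nonneg (hc.nonneg _)]
    exact hc.summable_mul_pow hz
  have hCs := (hc.summable_mul_pow hz).hasSum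
  have hprod := hasSum_coeff_mul_mul_pow hz.1 hcs hCs hEs hE
  rw [resolventSeries_mul (by positivity)] at hprod
  have h1 := hasSum_single (f := fun n => PowerSeries.coeff n (1 : PowerSeries ℝ) * z ^ n) 0
    (fun n hn => by simp [PowerSeries.coeff_one, hn])
  have huniq := hprod.unique h1
  have e : (1 - z) * (A + s * (1 - z)⁻¹) = (1 - z) * A + s := by field_simp
  rw [e] at huniq
  have : (1 - z) * A + s ≠ 0 := by positivity
  rw [← eq_inv_of_mul_eq_one_left (by simpa using huniq)]
  exact hCs

/-! ### The inverse square root as an integral of resolvents -/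

theorem half_mem_Ioo : (1 / 2 : ℝ) ∈ Ioo (0 : ℝ) 1 := by constructor <;> norm_num

/-- The normalizing constant `∫_0^∞ s^{-1/2} / (s + 1) ds`. -/
noncomputable def sqrtConst : ℝ := ∫ t in Ioi 0, Real.rpowIntegrand₀₁ (1 / 2) t 1

theorem sqrtConst_pos : 0 < sqrtConst := by
  have h := Real.rpow_eq_const_mul_integral half_mem_Ioo zero_le_one
  rw [Real.one_rpow] at h
  have h0 : 0 ≤ sqrtConst := setIntegral_nonneg measurableSet_Ioi fun t ht =>
    Real.rpowIntegrand₀₁_nonneg half_mem_Ioo.1 (le_of_lt ht) zero_le_one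
  refine h0.lt_of_ne fun h' => ?_
  rw [sqrtConst] at h'
  rw [← h'] at h
  simp at h

theorem rpowIntegrand_half_div {x t : ℝ} (hx : 0 < x) (ht : 0 ≤ t) :
    Real.rpowIntegrand₀₁ (1 / 2) t x / x = t ^ (-(1 / 2) : ℝ) * (x + t)⁻¹ := by
  rw [Real.rpowIntegrand₀₁_eq_pow_div half_mem_Ioo ht hx.le, add_comm t x]
  norm_num
  field_simp

theorem integrableOn_rpow_mul_inv {x : ℝ} (hx : 0 < x) :
    IntegrableOn (fun s : ℝ => s ^ (-(1 / 2) : ℝ) * (x + s)⁻¹) (Ioi 0) :=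
  IntegrableOn.congr_fun ((Real.integrableOn_rpowIntegrand₀₁_Ioi half_mem_Ioo hx.le).div_const x)
    (fun _ ht => rpowIntegrand_half_div hx (le_of_lt ht)) measurableSet_Ioi

theorem integral_rpow_mul_inv {x : ℝ} (hx : 0 < x) :
    ∫ s in Ioi 0, s ^ (-(1 / 2) : ℝ) * (x + s)⁻¹ = sqrtConst * (√x)⁻¹ := by
  rw [← setIntegral_congr_fun measurableSet_Ioi
    fun t ht => rpowIntegrand_half_div hx (le_of_lt (mem_Ioi.1 ht)), integral_div]
  have h := Real.rpow_eq_const_mul_integral half_mem_Ioo hx.le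
  rw [← Real.sqrt_eq_rpow, ← sqrtConst] at h
  have := sqrtConst_pos.ne'
  have h2 : ∫ t in Ioi 0, Real.rpowIntegrand₀₁ (1 / 2) t x = sqrtConst * √x := by
    rw [h]; field_simp
  have hs : √x ≠ 0 := (Real.sqrt_pos.2 hx).ne'
  rw [h2]
  nth_rewrite 2 [← Real.mul_self_sqrt hx.le]
  field_simp

theorem integrableOn_rpow_mul_coeff {a : ℕ → ℝ} (ha : IsCMSeq a) (h0 : 0 < a 0) (n : ℕ) :
    IntegrableOn (fun s : ℝ => s ^ (-(1 / 2) : ℝ) * PowerSeries.coeff n (resolventSeries a s))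
      (Ioi 0) := by
  refine (integrableOn_rpow_mul_inv h0).mono' ?_ ?_
  · exact ((measurable_id.pow_const _).mul (measurable_coeff_resolventSeries a n)).aestronglyMeasurable
  · filter_upwards [ae_restrict_mem measurableSet_Ioi] with s hs
    have hs0 : 0 < s := hs
    have hc := isCMSeq_resolventSeries ha h0 hs0.le
    rw [Real.norm_of_nonneg (mul_nonneg (by positivity) (hc.nonneg n)),
      ← coeff_zero_resolventSeries]
    exact mul_le_mul_of_nonneg_left (hc.antitone (Nat.zero_le n)) (by positivity)

/-- The coefficients of the power series `E^{-1/2}` with `E = (1 - X) ∑ a_n X^n`. -/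
noncomputable def invSqrtCoeff (a : ℕ → ℝ) (n : ℕ) : ℝ :=
  sqrtConst⁻¹ * ∫ s in Ioi 0, s ^ (-(1 / 2) : ℝ) * PowerSeries.coeff n (resolventSeries a s)

/-- Complete monotonicity is a family of linear inequalities in the sequence, so it survives
integration in `s` against a positive weight. -/
theorem isCMSeq_invSqrtCoeff {a : ℕ → ℝ} (ha : IsCMSeq a) (h0 : 0 < a 0) :
    IsCMSeq (invSqrtCoeff a) := by
  have key : ∀ p, IntegrableOn (fun s : ℝ => s ^ (-(1 / 2) : ℝ) *
      momentFunctional (fun n => PowerSeries.coeff n (resolventSeries a s)) p) (Ioi 0) ∧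
      momentFunctional (fun n => ∫ s in Ioi 0, s ^ (-(1 / 2) : ℝ) *
        PowerSeries.coeff n (resolventSeries a s)) p = ∫ s in Ioi 0, s ^ (-(1 / 2) : ℝ) *
      momentFunctional (fun n => PowerSeries.coeff n (resolventSeries a s)) p := by
    intro p
    induction p using Polynomial.induction_on' with
    | add p q hp hq =>
      simp only [map_add, mul_add]
      exact ⟨hp.1.add hq.1, by rw [hp.2, hq.2, integral_add hp.1 hq.1]⟩
    | monomial n r =>
      simp only [momentFunctional_monomial, ← mul_assoc]
      exact ⟨(integrableOn_rpow_mul_coeff ha h0 n).mul_const r, by rw [integral_mul_const]⟩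
  intro k m
  unfold invSqrtCoeff
  rw [momentFunctional_smul, (key _).2]
  refine mul_nonneg (inv_nonneg.2 sqrtConst_pos.le) (setIntegral_nonneg measurableSet_Ioi ?_)
  intro s hs
  exact mul_nonneg (Real.rpow_nonneg (le_of_lt hs) _)
    (isCMSeq_resolventSeries ha h0 (le_of_lt hs) k m)

theorem hasSum_invSqrtCoeff {a : ℕ → ℝ} (ha : IsCMSeq a) (h0 : 0 < a 0)
    {z A : ℝ} (hz : z ∈ Ico (0 : ℝ) 1) (hA : HasSum (fun n => a n * z ^ n) A) :
    HasSum (fun n => invSqrtCoeff a n * z ^ n) (√((1 - z) * A))⁻¹ := by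
  have hz1 : 0 < 1 - z := by linarith [hz.2]
  have hA0 : 0 < A := by
    have := le_hasSum hA 0 fun n _ => mul_nonneg (ha.nonneg n) (pow_nonneg hz.1 n)
    simp at this; linarith
  have hcm := isCMSeq_invSqrtCoeff ha h0
  have hpos : ∀ n, ∀ s ∈ Ioi (0 : ℝ), 0 ≤
      s ^ (-(1 / 2) : ℝ) * PowerSeries.coeff n (resolventSeries a s) * z ^ n := fun n s hs =>
    mul_nonneg (mul_nonneg (Real.rpow_nonneg (le_of_lt hs) _)
      ((isCMSeq_resolventSeries ha h0 (le_of_lt hs)).nonneg n)) (pow_nonneg hz.1 n)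
  have hK := sqrtConst_pos.ne'
  have h := hasSum_integral_of_summable_integral_norm (μ := volume.restrict (Ioi 0))
    (F := fun n s => s ^ (-(1 / 2) : ℝ) * PowerSeries.coeff n (resolventSeries a s) * z ^ n)
    (fun n => (integrableOn_rpow_mul_coeff ha h0 n).mul_const _) ?_
  · simp only [integral_mul_const] at h
    have e : ∫ s in Ioi 0, ∑' n, s ^ (-(1 / 2) : ℝ) *
        PowerSeries.coeff n (resolventSeries a s) * z ^ n = sqrtConst * (√((1 - z) * A))⁻¹ := by
      rw [← integral_rpow_mul_inv (by positivity)]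
      refine setIntegral_congr_fun measurableSet_Ioi fun s hs => ?_
      simp only [mul_assoc]
      exact ((hasSum_resolventSeries ha h0 (le_of_lt hs) hz hA).mul_left _).tsum_eq
    rw [e] at h
    have h' := h.mul_left sqrtConst⁻¹
    rw [inv_mul_cancel_left₀ hK] at h'
    simpa only [invSqrtCoeff, mul_assoc] using h'
  · have e : ∀ n, ∫ s in Ioi 0, ‖s ^ (-(1 / 2) : ℝ) *
        PowerSeries.coeff n (resolventSeries a s) * z ^ n‖ =
        sqrtConst * (invSqrtCoeff a n * z ^ n) := by
      intro n
      rw [setIntegral_congr_fun measurableSet_Ioi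
        (fun s hs => Real.norm_of_nonneg (hpos n s hs)), integral_mul_const, invSqrtCoeff,
        ← mul_assoc, mul_inv_cancel_left₀ hK]
    simp only [e]
    exact (hcm.summable_mul_pow hz).mul_left _

end Viscoelastic

namespace Viscoelastic

open MeasureTheory Filter Topology Set unitInterval

/-! ### Stieltjes functions in the compactified variable `x = 1 / (1 + r)` -/

/-- The Stieltjes function `∫ μ(dx) / (1 + x (p - 1))` over the unit interval. -/
noncomputable def stieltjesTransform (μ : Measure I) (p : ℂ) : ℂ :=
  ∫ x : I, (1 + (x : ℝ) * (p - 1))⁻¹ ∂μ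

/-- The real part is a convex combination of `1` and `p.re`, which keeps the kernel bounded
uniformly in `x`. -/
theorem min_le_re_one_add_mul (x : I) (p : ℂ) :
    min 1 p.re ≤ (1 + ((x : ℝ) : ℂ) * (p - 1)).re := by
  have hx := x.2
  have e : (1 + ((x : ℝ) : ℂ) * (p - 1)).re = (1 - (x : ℝ)) * 1 + x * p.re := by simp; ring
  rw [e]
  have h1 : min 1 p.re ≤ 1 := min_le_left _ _
  have h2 : min 1 p.re ≤ p.re := min_le_right _ _
  nlinarith [hx.1, hx.2]

theorem one_add_mul_re_pos (x : I) {p : ℂ} (hp : 0 < p.re) :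
    0 < (1 + ((x : ℝ) : ℂ) * (p - 1)).re :=
  (lt_min zero_lt_one hp).trans_le (min_le_re_one_add_mul x p)

theorem one_add_mul_ne_zero (x : I) {p : ℂ} (hp : 0 < p.re) : 1 + ((x : ℝ) : ℂ) * (p - 1) ≠ 0 := by
  intro h
  have := one_add_mul_re_pos x hp
  rw [h] at this
  simp at this

theorem continuous_stieltjesKernel {p : ℂ} (hp : 0 < p.re) :
    Continuous fun x : I => (1 + ((x : ℝ) : ℂ) * (p - 1))⁻¹ :=
  Continuous.inv₀ (by fun_prop) fun x => one_add_mul_ne_zero x hp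

theorem norm_stieltjesKernel_le (x : I) {p : ℂ} (hp : 0 < p.re) :
    ‖(1 + ((x : ℝ) : ℂ) * (p - 1))⁻¹‖ ≤ (min 1 p.re)⁻¹ := by
  rw [norm_inv]
  gcongr
  exact (min_le_re_one_add_mul x p).trans (Complex.re_le_norm _)

theorem integrable_stieltjesKernel (μ : Measure I) [IsFiniteMeasure μ] {p : ℂ} (hp : 0 < p.re) :
    Integrable (fun x : I => (1 + ((x : ℝ) : ℂ) * (p - 1))⁻¹) μ :=
  Integrable.of_bound (continuous_stieltjesKernel hp).aestronglyMeasurable _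
    (Eventually.of_forall fun x => norm_stieltjesKernel_le x hp)

theorem differentiableAt_stieltjesTransform (μ : Measure I) [IsFiniteMeasure μ] {p : ℂ}
    (hp : 0 < p.re) : DifferentiableAt ℂ (stieltjesTransform μ) p := by
  have hopen : {q : ℂ | p.re / 2 < q.re} ∈ 𝓝 p :=
    (isOpen_lt continuous_const Complex.continuous_re).mem_nhds (by simp; linarith)
  have hder : ∀ (x : I) (q : ℂ), 0 < q.re →
      HasDerivAt (fun q : ℂ => (1 + ((x : ℝ) : ℂ) * (q - 1))⁻¹)
        (-((x : ℝ) : ℂ) / (1 + ((x : ℝ) : ℂ) * (q - 1)) ^ 2) q := by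
    intro x q hq
    have h1 : HasDerivAt (fun q : ℂ => 1 + ((x : ℝ) : ℂ) * (q - 1)) ((x : ℝ) : ℂ) q := by
      simpa using (((hasDerivAt_id q).sub_const 1).const_mul ((x : ℝ) : ℂ)).const_add 1
    exact h1.inv (one_add_mul_ne_zero x hq)
  refine (hasDerivAt_integral_of_dominated_loc_of_deriv_le (μ := μ)
    (F := fun (q : ℂ) (x : I) => (1 + ((x : ℝ) : ℂ) * (q - 1))⁻¹)
    (F' := fun (q : ℂ) (x : I) => -((x : ℝ) : ℂ) / (1 + ((x : ℝ) : ℂ) * (q - 1)) ^ 2)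
    (bound := fun _ => ((min 1 (p.re / 2))⁻¹) ^ 2)
    hopen ?_ (integrable_stieltjesKernel μ hp) ?_ ?_ (integrable_const _) ?_).2.differentiableAt
  · filter_upwards [hopen] with q hq
    have hq' : p.re / 2 < q.re := hq
    exact (continuous_stieltjesKernel (by linarith)).aestronglyMeasurable
  · refine Continuous.aestronglyMeasurable ?_
    exact Continuous.div (by fun_prop) (by fun_prop)
      fun x => pow_ne_zero _ (one_add_mul_ne_zero x hp)
  · refine Eventually.of_forall fun x q hq => ?_
    have hq' : p.re / 2 < q.re := hq
    have hq0 : 0 < q.re := by linarith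
    have h1 := norm_stieltjesKernel_le x hq0
    rw [div_eq_mul_inv, norm_mul, ← inv_pow, norm_pow, norm_neg, Complex.norm_real,
      Real.norm_of_nonneg x.2.1]
    have h2 : (min 1 q.re)⁻¹ ≤ (min 1 (p.re / 2))⁻¹ := by
      have : 0 < min 1 (p.re / 2) := lt_min zero_lt_one (by linarith)
      gcongr
    calc (x : ℝ) * ‖(1 + ((x : ℝ) : ℂ) * (q - 1))⁻¹‖ ^ 2
        ≤ 1 * ((min 1 (p.re / 2))⁻¹) ^ 2 := by
          gcongr
          · exact x.2.2
          · exact h1.trans h2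
      _ = _ := one_mul _
  · refine Eventually.of_forall fun x q hq => hder x q ?_
    have hq' : p.re / 2 < q.re := hq
    linarith

theorem stieltjesTransform_ofReal_of_hasSum {μ : Measure I} [IsFiniteMeasure μ] {c : ℕ → ℝ}
    (hμ : ∀ n, ∫ x : I, (x : ℝ) ^ n ∂μ = c n) {p : ℝ} (hp : p ∈ Ioc (0 : ℝ) 1) {S : ℝ}
    (hS : HasSum (fun n => c n * (1 - p) ^ n) S) : stieltjesTransform μ p = S := by
  have hz : 0 ≤ 1 - p := by linarith [hp.2]
  have hz1 : 1 - p < 1 := by linarith [hp.1]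
  have hi : ∀ n, Integrable (fun x : I => (x : ℝ) ^ n * (1 - p) ^ n) μ := fun n =>
    BoundedContinuousFunction.integrable μ (BoundedContinuousFunction.mkOfCompact
      ⟨fun x : I => (x : ℝ) ^ n * (1 - p) ^ n, by fun_prop⟩)
  have h := hasSum_integral_of_summable_integral_norm (μ := μ)
    (F := fun n (x : I) => (x : ℝ) ^ n * (1 - p) ^ n) hi ?_
  · simp only [integral_mul_const, hμ] at h
    rw [hS.unique h, stieltjesTransform, ← integral_complex_ofReal]
    refine integral_congr_ae (Eventually.of_forall fun x => ?_)
    simp only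
    have hx := x.2
    have hxz : (x : ℝ) * (1 - p) < 1 := by nlinarith [hx.1, hx.2]
    have hg := (hasSum_geometric_of_lt_one (mul_nonneg hx.1 hz) hxz).tsum_eq
    simp only [← mul_pow]
    rw [hg]
    push_cast
    congr 1; ring
  · have e : ∀ n, ∫ x : I, ‖(x : ℝ) ^ n * (1 - p) ^ n‖ ∂μ = c n * (1 - p) ^ n := by
      intro n
      rw [← hμ, ← integral_mul_const]
      refine integral_congr_ae (Eventually.of_forall fun x => ?_)
      exact Real.norm_of_nonneg (mul_nonneg (pow_nonneg x.2.1 n) (pow_nonneg hz n))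
    simp only [e]
    exact hS.summable

theorem eq_stieltjesTransform_of_forall_real {f : ℂ → ℂ}
    (hf : ∀ p : ℂ, 0 < p.re → DifferentiableAt ℂ f p) {μ : Measure I} [IsFiniteMeasure μ]
    (h : ∀ p : ℝ, p ∈ Ioc (0 : ℝ) 1 → f p = stieltjesTransform μ p) {p : ℂ} (hp : 0 < p.re) :
    f p = stieltjesTransform μ p := by
  have hopen : IsOpen {q : ℂ | 0 < q.re} := isOpen_lt continuous_const Complex.continuous_re
  have hconv : Convex ℝ {q : ℂ | 0 < q.re} := convex_halfSpace_re_gt 0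
  have hmem : ((1 / 2 : ℝ) : ℂ) ∈ {q : ℂ | 0 < q.re} := by
    simp only [mem_ofPred_eq, Complex.ofReal_re]; norm_num
  refine AnalyticOnNhd.eqOn_of_preconnected_of_frequently_eq
    (DifferentiableOn.analyticOnNhd (fun q hq => (hf q hq).differentiableWithinAt) hopen)
    (DifferentiableOn.analyticOnNhd
      (fun q hq => (differentiableAt_stieltjesTransform μ hq).differentiableWithinAt) hopen)
    hconv.isPreconnected hmem ?_ hp
  have ht : Tendsto (fun x : ℝ => (x : ℂ)) (𝓝[≠] (1 / 2)) (𝓝[≠] ((1 / 2 : ℝ) : ℂ)) := by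
    refine tendsto_nhdsWithin_iff.2 ⟨(Complex.continuous_ofReal.tendsto _).mono_left
      nhdsWithin_le_nhds, ?_⟩
    filter_upwards [self_mem_nhdsWithin] with x hx
    simpa only [mem_compl_iff, mem_singleton_iff, Complex.ofReal_inj] using hx
  refine ht.frequently (Eventually.frequently ?_)
  filter_upwards [nhdsWithin_le_nhds (Ioc_mem_nhds (a := (0 : ℝ)) (b := 1)
    (x := 1 / 2) (by norm_num) (by norm_num))] with x hx using h x hx

/-- Pointwise in `x`, the real part has numerator `(1 - x) Re p + x |p|²`. This keeps the modulus
off the branch cut of the principal root. -/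
theorem mul_stieltjesTransform_re_pos {μ : Measure I} [IsFiniteMeasure μ] (hμ : μ univ ≠ 0) {p : ℂ}
    (hp : 0 < p.re) : 0 < (p * stieltjesTransform μ p).re := by
  rw [stieltjesTransform, ← integral_const_mul, ← RCLike.re_eq_complex_re,
    ← integral_re ((integrable_stieltjesKernel μ hp).const_mul p)]
  have hpos : ∀ x : I, 0 < RCLike.re (p * (1 + ((x : ℝ) : ℂ) * (p - 1))⁻¹) := by
    intro x
    have hx := x.2
    have h0 := one_add_mul_ne_zero x hp
    have hn := Complex.normSq_pos.2 h0
    have hpn : 0 < p.re ^ 2 + p.im ^ 2 := by positivity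
    have e : (p * (1 + ((x : ℝ) : ℂ) * (p - 1))⁻¹).re =
        ((1 - x) * p.re + x * (p.re ^ 2 + p.im ^ 2)) /
          Complex.normSq (1 + ((x : ℝ) : ℂ) * (p - 1)) := by
      rw [← div_eq_mul_inv, Complex.div_re, ← add_div]
      congr 1
      simp; ring
    rw [RCLike.re_eq_complex_re, e]
    refine div_pos ?_ hn
    rcases hx.1.eq_or_lt with h | h
    · rw [← h]; simpa using hp
    · have : 0 ≤ (1 - (x : ℝ)) * p.re := mul_nonneg (by linarith [hx.2]) hp.le
      positivity
  rw [integral_pos_iff_support_of_nonneg (fun x => (hpos x).le)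
    ((integrable_stieltjesKernel μ hp).const_mul p).re]
  have : Function.support (fun x : I => RCLike.re (p * (1 + ((x : ℝ) : ℂ) * (p - 1))⁻¹)) = univ :=
    eq_univ_of_forall fun x => (hpos x).ne'
  rw [this]
  exact pos_iff_ne_zero.2 hμ

/-! ### The modulus -/

theorem IsCM.le_of_tendsto {G : ℝ → ℝ} (hG : IsCM G) {Ginf : ℝ} (h : Tendsto G atTop (𝓝 Ginf))
    {t : ℝ} (ht : 0 < t) : Ginf ≤ G t := by
  refine _root_.le_of_tendsto h ?_
  filter_upwards [eventually_ge_atTop t] with s hs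
  exact hG.antitoneOn ht (ht.trans_le hs) hs

/-- The modulus `p ∫_0^∞ e^{-pt} G(t) dt` at real arguments. -/
noncomputable def realModulus (G : ℝ → ℝ) (p : ℝ) : ℝ := p * ∫ t in Ioi 0, Real.exp (-p * t) * G t

theorem modulus_ofReal (G : ℝ → ℝ) (p : ℝ) : modulus G p = realModulus G p := by
  rw [modulus, laplace_ofReal, realModulus]; push_cast; rfl

theorem integral_exp_neg_mul_Ioi_zero {p : ℝ} (hp : 0 < p) :
    ∫ t in Ioi (0 : ℝ), Real.exp (-p * t) = p⁻¹ := by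
  rw [integral_exp_mul_Ioi (by linarith)]; simp

theorem le_realModulus {G : ℝ → ℝ} (hG : IsLICM G) {Ginf : ℝ} (h : Tendsto G atTop (𝓝 Ginf))
    {p : ℝ} (hp : 0 < p) : Ginf ≤ realModulus G p := by
  have h1 : ∫ t in Ioi 0, Real.exp (-p * t) * Ginf ≤ ∫ t in Ioi 0, Real.exp (-p * t) * G t :=
    setIntegral_mono_on ((exp_neg_integrableOn_Ioi 0 hp).mul_const _) (hG.integrableOn_exp_mul hp)
      measurableSet_Ioi fun t ht =>
        mul_le_mul_of_nonneg_left (hG.1.le_of_tendsto h ht) (Real.exp_nonneg _)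
  rw [integral_mul_const, integral_exp_neg_mul_Ioi_zero hp] at h1
  calc Ginf = p * (p⁻¹ * Ginf) := by field_simp
    _ ≤ _ := mul_le_mul_of_nonneg_left h1 hp.le

theorem laplaceCoeff_zero_pos {G : ℝ → ℝ} (hG : IsLICM G) {Ginf : ℝ} (hpos : 0 < Ginf)
    (h : Tendsto G atTop (𝓝 Ginf)) : 0 < laplaceCoeff G 0 := by
  have h1 := hpos.trans_le (le_realModulus hG h zero_lt_one)
  simpa [realModulus, laplaceCoeff, gammaIntegrand, altDeriv_zero] using h1

theorem modulus_re_pos {G : ℝ → ℝ} (hG : IsLICM G) {Ginf : ℝ} (hpos : 0 < Ginf)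
    (h : Tendsto G atTop (𝓝 Ginf)) {p : ℂ} (hp : 0 < p.re) : 0 < (modulus G p).re := by
  obtain ⟨μ, _, hμ⟩ := exists_measure_of_isCMSeq (isCMSeq_laplaceCoeff hG)
  rw [modulus, eq_stieltjesTransform_of_forall_real (f := laplace G) (μ := μ)
    (fun q hq => differentiableAt_laplace hG hq) ?_ hp]
  · refine mul_stieltjesTransform_re_pos (fun h0 => ?_) hp
    have h1 := hμ 0
    have h2 := laplaceCoeff_zero_pos hG hpos h
    rw [Measure.measure_univ_eq_zero.1 h0] at h1
    simp at h1; linarith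
  · intro q hq
    rw [laplace_ofReal, stieltjesTransform_ofReal_of_hasSum hμ hq (hasSum_laplaceCoeff hG hq)]

theorem exists_stieltjesTransform_eq_inv_sqrt_modulus {G : ℝ → ℝ} (hG : IsLICM G) {Ginf : ℝ}
    (hpos : 0 < Ginf) (h : Tendsto G atTop (𝓝 Ginf)) :
    ∃ μ : Measure I, IsFiniteMeasure μ ∧ ∀ p : ℂ, 0 < p.re →
      (modulus G p ^ (1 / 2 : ℂ))⁻¹ = stieltjesTransform μ p := by
  have h0 := laplaceCoeff_zero_pos hG hpos h
  have ha := isCMSeq_laplaceCoeff hG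
  obtain ⟨μ, hfin, hμ⟩ := exists_measure_of_isCMSeq (isCMSeq_invSqrtCoeff ha h0)
  refine ⟨μ, hfin, fun p hp => ?_⟩
  refine eq_stieltjesTransform_of_forall_real (f := fun p => (modulus G p ^ (1 / 2 : ℂ))⁻¹)
    (fun q hq => ?_) (fun q hq => ?_) hp
  · have hre := modulus_re_pos hG hpos h hq
    have hne : modulus G q ≠ 0 := fun h0 => by rw [h0] at hre; simp at hre
    have hd : DifferentiableAt ℂ (modulus G) q :=
      differentiableAt_id.mul (differentiableAt_laplace hG hq)
    refine DifferentiableAt.inv (hd.cpow_const (Or.inl hre)) ?_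
    rw [Complex.cpow_ne_zero_iff]
    exact Or.inl hne
  · have hs := hasSum_invSqrtCoeff ha h0 (z := 1 - q) ⟨by linarith [hq.2], by linarith [hq.1]⟩
      (hasSum_laplaceCoeff hG hq)
    rw [stieltjesTransform_ofReal_of_hasSum hμ hq hs, modulus_ofReal, sub_sub_cancel]
    change _ = (((√(realModulus G q))⁻¹ : ℝ) : ℂ)
    rw [Real.sqrt_eq_rpow, Complex.ofReal_inv, Complex.ofReal_cpow
      (hpos.le.trans (le_realModulus hG h hq.1))]
    norm_num

end Viscoelastic

namespace Viscoelastic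

open MeasureTheory Filter Topology Set unitInterval

/-! ### The spectral measure of a Stieltjes function -/

/-- The interior `0 < x < 1` of the unit interval. -/
def innerInterval : Set I := {x | (0 : ℝ) < x ∧ (x : ℝ) < 1}

theorem measurableSet_innerInterval : MeasurableSet innerInterval :=
  (measurableSet_lt measurable_const measurable_subtype_coe).inter
    (measurableSet_lt measurable_subtype_coe measurable_const)

/-- The change of variable `r = 1 / x - 1`. -/
noncomputable def radius (x : I) : ℝ := (x : ℝ)⁻¹ - 1

theorem measurable_radius : Measurable radius := by unfold radius; fun_prop

theorem radius_preimage_Ioi : radius ⁻¹' Ioi 0 = innerInterval := by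
  ext x
  simp only [mem_preimage, mem_Ioi, radius, sub_pos, innerInterval, mem_ofPred_eq]
  rw [one_lt_inv_iff₀]

/-- The measure `(1 + r) τ(dx)` on `0 < x < 1`. -/
noncomputable def innerMeasure (τ : Measure I) : Measure I :=
  (τ.restrict innerInterval).withDensity fun x => ENNReal.ofReal ((x : ℝ)⁻¹)

theorem measurable_innerDensity : Measurable fun x : I => ENNReal.ofReal ((x : ℝ)⁻¹) := by fun_prop

theorem innerMeasure_restrict (τ : Measure I) :
    (innerMeasure τ).restrict innerInterval = innerMeasure τ := by
  rw [innerMeasure, restrict_withDensity measurableSet_innerInterval,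
    Measure.restrict_restrict measurableSet_innerInterval, inter_self]

/-- The spectral measure on the half-line belonging to a measure on the unit interval. -/
noncomputable def spectralMeasure (τ : Measure I) : Measure ℝ := (innerMeasure τ).map radius

theorem spectralMeasure_restrict (τ : Measure I) :
    (spectralMeasure τ).restrict (Ioi 0) = spectralMeasure τ := by
  rw [spectralMeasure, Measure.restrict_map measurable_radius measurableSet_Ioi,
    radius_preimage_Ioi, innerMeasure_restrict]

/-- The density `x⁻¹ = 1 + r` is bounded where `r` is, and it cancels the weight `1 / (1 + r)`
exactly. -/
theorem isSpectralMeasure_spectralMeasure (τ : Measure I) [IsFiniteMeasure τ] :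
    IsSpectralMeasure (spectralMeasure τ) := by
  refine ⟨⟨fun r => ⟨Iio (r + 1), Iio_mem_nhds (by linarith), ?_⟩⟩, ?_, ?_⟩
  · rw [spectralMeasure, Measure.map_apply measurable_radius measurableSet_Iio, innerMeasure,
      withDensity_apply _ (measurable_radius measurableSet_Iio)]
    have h : ∀ x ∈ radius ⁻¹' Iio (r + 1),
        ENNReal.ofReal ((x : ℝ)⁻¹) ≤ ENNReal.ofReal (r + 2) := by
      intro x hx
      have hx' : (x : ℝ)⁻¹ - 1 < r + 1 := hx
      exact ENNReal.ofReal_le_ofReal (by linarith)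
    refine (setLIntegral_mono measurable_const h).trans_lt ?_
    rw [setLIntegral_const]
    exact ENNReal.mul_lt_top ENNReal.ofReal_lt_top (measure_lt_top _ _)
  · rw [← spectralMeasure_restrict, Measure.restrict_apply measurableSet_Iio]
    have : Iio (0 : ℝ) ∩ Ioi 0 = ∅ := by
      ext r; simp only [mem_inter_iff, mem_Iio, mem_Ioi, mem_empty_iff_false, iff_false]
      rintro ⟨h1, h2⟩; linarith
    rw [this, measure_empty]
  · rw [spectralMeasure_restrict, spectralMeasure, lintegral_map (by fun_prop) measurable_radius,
      innerMeasure, lintegral_withDensity_eq_lintegral_mul _ measurable_innerDensity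
        (Measurable.ennreal_ofReal ((measurable_radius.const_add 1).const_div 1))]
    have h : ∀ x ∈ innerInterval, ((fun x : I => ENNReal.ofReal ((x : ℝ)⁻¹)) *
        fun x => ENNReal.ofReal (1 / (1 + radius x))) x ≤ 1 := by
      intro x hx
      have hx0 : (0 : ℝ) < x := hx.1
      simp only [Pi.mul_apply, radius]
      rw [← ENNReal.ofReal_mul (by positivity)]
      simp [hx0.ne']
    refine (setLIntegral_mono measurable_const h).trans_lt ?_
    rw [setLIntegral_const, one_mul]
    exact measure_lt_top _ _

/-- With `x = 1 / (1 + r)`, the kernel `1 / (1 + x (p - 1))` is `(1 + r) / (p + r)`. -/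
theorem dispersionAttenuation_spectralMeasure (τ : Measure I) [IsFiniteMeasure τ] {p : ℂ}
    (hp : 0 < p.re) : dispersionAttenuation (spectralMeasure τ) p =
      p * ∫ x in innerInterval, (1 + ((x : ℝ) : ℂ) * (p - 1))⁻¹ ∂τ := by
  rw [dispersionAttenuation, spectralMeasure_restrict, spectralMeasure,
    integral_map measurable_radius.aemeasurable
      (Measurable.aestronglyMeasurable (by fun_prop)), innerMeasure,
    integral_withDensity_eq_integral_toReal_smul measurable_innerDensity
      (Eventually.of_forall fun x => ENNReal.ofReal_lt_top)]
  congr 1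
  refine setIntegral_congr_fun measurableSet_innerInterval fun x hx => ?_
  have hx0 : (0 : ℝ) < x := hx.1
  have hxc : ((x : ℝ) : ℂ) ≠ 0 := by exact_mod_cast hx0.ne'
  have h0 := one_add_mul_ne_zero x hp
  simp only [radius]
  rw [ENNReal.toReal_ofReal (by positivity), Complex.real_smul]
  push_cast
  rw [one_div, ← mul_inv]
  congr 1
  field_simp
  ring

theorem stieltjesTransform_eq_add {τ : Measure I} [IsFiniteMeasure τ] (h1 : τ {1} = 0) {p : ℂ}
    (hp : 0 < p.re) : stieltjesTransform τ p =
      τ.real {0} + ∫ x in innerInterval, (1 + ((x : ℝ) : ℂ) * (p - 1))⁻¹ ∂τ := by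
  rw [stieltjesTransform, ← integral_add_compl measurableSet_innerInterval
    (integrable_stieltjesKernel τ hp), add_comm]
  congr 1
  have e : innerIntervalᶜ = {0} ∪ ({1} : Set I) := by
    ext x
    have hx := x.2
    simp only [innerInterval, mem_compl_iff, mem_ofPred_eq, not_and_or, not_lt, mem_union,
      mem_singleton_iff]
    refine or_congr ⟨fun h => Subtype.ext (le_antisymm h hx.1), ?_⟩
      ⟨fun h => Subtype.ext (le_antisymm hx.2 h), ?_⟩ <;> rintro rfl <;> simp
  have e2 : (innerIntervalᶜ : Set I) =ᵐ[τ] ({0} : Set I) := by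
    rw [e]
    exact union_ae_eq_left_of_ae_eq_empty (ae_eq_empty.2 h1)
  rw [setIntegral_congr_set e2, integral_singleton]
  simp

/-- At `x = 1` the kernel is `1 / p`, so boundedness as `p → 0+` leaves no room for an atom there.
-/
theorem measure_singleton_one_eq_zero {μ : Measure I} [IsFiniteMeasure μ] {M : ℝ}
    (h : ∀ p : ℝ, p ∈ Ioc (0 : ℝ) 1 → ‖stieltjesTransform μ p‖ ≤ M) : μ {1} = 0 := by
  have key : ∀ p : ℝ, p ∈ Ioc (0 : ℝ) 1 → μ.real {1} ≤ M * p := by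
    intro p hp
    have hp0 : 0 < (p : ℂ).re := by simpa using hp.1
    have hpos : ∀ x : I, 0 < 1 + (x : ℝ) * (p - 1) := by
      intro x
      have := one_add_mul_re_pos x hp0
      simpa using this
    have e : stieltjesTransform μ p = ((∫ x : I, (1 + (x : ℝ) * (p - 1))⁻¹ ∂μ : ℝ) : ℂ) := by
      rw [stieltjesTransform, ← integral_complex_ofReal]
      congr 1; ext x; push_cast; rfl
    have hint : Integrable (fun x : I => (1 + (x : ℝ) * (p - 1))⁻¹) μ := by
      have := (integrable_stieltjesKernel μ hp0).re
      refine this.congr (Eventually.of_forall fun x => ?_)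
      have e : (1 + ((x : ℝ) : ℂ) * ((p : ℂ) - 1))⁻¹ =
          (((1 + (x : ℝ) * (p - 1))⁻¹ : ℝ) : ℂ) := by push_cast; rfl
      simp only [e]
      exact Complex.ofReal_re _
    have h1 : ∫ x in {(1 : I)}, (1 + (x : ℝ) * (p - 1))⁻¹ ∂μ ≤
        ∫ x : I, (1 + (x : ℝ) * (p - 1))⁻¹ ∂μ :=
      setIntegral_le_integral hint (Eventually.of_forall fun x => (inv_pos.2 (hpos x)).le)
    have h2 := h p hp
    rw [e, Complex.norm_real] at h2
    have h3 := h1.trans ((le_abs_self _).trans h2)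
    rw [integral_singleton] at h3
    simp only [Set.Icc.coe_one, smul_eq_mul, one_mul, add_sub_cancel] at h3
    rwa [← div_eq_mul_inv, div_le_iff₀ hp.1] at h3
  have hlim : Tendsto (fun p : ℝ => M * p) (𝓝[>] 0) (𝓝 0) := by
    have : Tendsto (fun p : ℝ => M * p) (𝓝 0) (𝓝 (M * 0)) := tendsto_id.const_mul M
    rw [mul_zero] at this
    exact this.mono_left nhdsWithin_le_nhds
  have hle : μ.real {1} ≤ 0 := by
    refine ge_of_tendsto hlim ?_
    filter_upwards [Ioc_mem_nhdsGT zero_lt_one] with p hp using key p hp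
  exact (measureReal_eq_zero_iff).1 (le_antisymm hle measureReal_nonneg)

theorem exists_representsWaveNumber {ρ : ℝ} {G : ℝ → ℝ} (hG : IsLICM G) {Ginf : ℝ}
    (hpos : 0 < Ginf) (h : Tendsto G atTop (𝓝 Ginf)) :
    ∃ (B : ℝ) (ν : Measure ℝ), RepresentsWaveNumber ρ G B ν := by
  obtain ⟨μ, _, hμ⟩ := exists_stieltjesTransform_eq_inv_sqrt_modulus hG hpos h
  have h1 : μ {1} = 0 := by
    refine measure_singleton_one_eq_zero (M := (Ginf ^ (1 / 2 : ℝ))⁻¹) fun p hp => ?_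
    have hQ := le_realModulus hG h hp.1
    rw [← hμ p (by simpa using hp.1), norm_inv, modulus_ofReal]
    rw [Complex.norm_cpow_eq_rpow_re_of_pos (hpos.trans_le hQ)]
    have : (1 / 2 : ℂ).re = 1 / 2 := by norm_num
    rw [this]
    gcongr
  let τ : Measure I := ENNReal.ofReal √ρ • μ
  have hτ : IsFiniteMeasure τ := Measure.smul_finite _ ENNReal.ofReal_ne_top
  have hτ1 : τ {1} = 0 := by simp [τ, h1]
  refine ⟨τ.real {0}, spectralMeasure τ, measureReal_nonneg, isSpectralMeasure_spectralMeasure τ,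
    fun p hp => ?_⟩
  have e : stieltjesTransform τ p = (√ρ : ℂ) * stieltjesTransform μ p := by
    simp only [stieltjesTransform, τ]
    rw [integral_smul_measure, ENNReal.toReal_ofReal (Real.sqrt_nonneg _), Complex.real_smul]
  rw [dispersionAttenuation_spectralMeasure τ hp, mul_comm _ p, ← mul_add,
    ← stieltjesTransform_eq_add hτ1 hp, e, ← hμ p hp, waveNumber]
  ring

end Viscoelastic

namespace Viscoelastic

open MeasureTheory Filter Topology Set

/-! ### The wavefront speed -/

theorem realModulus_eq_integral {G : ℝ → ℝ} {p : ℝ} (hp : 0 < p) :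
    realModulus G p = ∫ u in Ioi 0, Real.exp (-u) * G (u / p) := by
  have h := integral_comp_mul_left_Ioi (fun u => Real.exp (-u) * G (u / p)) 0 hp
  simp only [mul_div_cancel_left₀ _ hp.ne', mul_zero, smul_eq_mul] at h
  rw [realModulus]
  simp only [neg_mul]
  rw [h, mul_inv_cancel_left₀ hp.ne']

theorem continuousOn_exp_neg_mul_comp_div {G : ℝ → ℝ} (hG : IsCM G) {p : ℝ} (hp : 0 < p) :
    ContinuousOn (fun u => Real.exp (-u) * G (u / p)) (Ioi 0) :=
  ContinuousOn.mul (by fun_prop)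
    (hG.continuousOn.comp (by fun_prop) fun _ hu => div_pos (mem_Ioi.1 hu) hp)

theorem tendsto_const_div_atTop_nhdsGT {u : ℝ} (hu : 0 < u) :
    Tendsto (fun p : ℝ => u / p) atTop (𝓝[>] 0) := by
  refine tendsto_nhdsWithin_iff.2 ⟨tendsto_const_nhds.div_atTop tendsto_id, ?_⟩
  filter_upwards [eventually_gt_atTop 0] with p hp using div_pos hu hp

theorem IsCM.le_of_tendsto_zero {G : ℝ → ℝ} (hG : IsCM G) {G₀ : ℝ}
    (h : Tendsto G (𝓝[>] 0) (𝓝 G₀)) {t : ℝ} (ht : 0 < t) : G t ≤ G₀ := by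
  refine ge_of_tendsto h ?_
  filter_upwards [Ioc_mem_nhdsGT ht] with s hs using hG.antitoneOn hs.1 ht hs.2

/-- After rescaling, the modulus averages `G (u / p)` against `e^{-u} du`; dominated convergence
applies because `G ≤ G₀`. -/
theorem tendsto_realModulus {G : ℝ → ℝ} (hG : IsLICM G) {G₀ : ℝ}
    (h : Tendsto G (𝓝[>] 0) (𝓝 G₀)) : Tendsto (realModulus G) atTop (𝓝 G₀) := by
  have hexp : IntegrableOn (fun u : ℝ => Real.exp (-u)) (Ioi 0) := by
    simpa using exp_neg_integrableOn_Ioi 0 zero_lt_one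
  have hlim : Tendsto (fun p : ℝ => ∫ u in Ioi 0, Real.exp (-u) * G (u / p)) atTop
      (𝓝 (∫ u in Ioi (0 : ℝ), Real.exp (-u) * G₀)) := by
    refine tendsto_integral_filter_of_dominated_convergence (fun u => Real.exp (-u) * G₀) ?_ ?_
      (hexp.mul_const _) ?_
    · filter_upwards [eventually_gt_atTop 0] with p hp
      exact (continuousOn_exp_neg_mul_comp_div hG.1 hp).aestronglyMeasurable measurableSet_Ioi
    · filter_upwards [eventually_gt_atTop 0] with p hp
      filter_upwards [ae_restrict_mem measurableSet_Ioi] with u hu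
      have hup : 0 < u / p := div_pos hu hp
      rw [Real.norm_of_nonneg (mul_nonneg (Real.exp_nonneg _) (hG.1.nonneg hup))]
      exact mul_le_mul_of_nonneg_left (hG.1.le_of_tendsto_zero h hup) (Real.exp_nonneg _)
    · filter_upwards [ae_restrict_mem measurableSet_Ioi] with u hu
      exact (h.comp (tendsto_const_div_atTop_nhdsGT hu)).const_mul _
  rw [integral_mul_const, integral_exp_neg_Ioi_zero, one_mul] at hlim
  refine hlim.congr' ?_
  filter_upwards [eventually_gt_atTop 0] with p hp using (realModulus_eq_integral hp).symm

theorem IsCM.tendsto_atTop_of_not_exists {G : ℝ → ℝ} (hG : IsCM G)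
    (h : ¬ ∃ G₀ : ℝ, Tendsto G (𝓝[>] 0) (𝓝 G₀)) : Tendsto G (𝓝[>] 0) atTop := by
  have hb : ¬ BddAbove (G '' Ioi 0) := fun hb => h ⟨_, hG.antitoneOn.tendsto_nhdsGT hb⟩
  refine tendsto_atTop.2 fun M => ?_
  rw [not_bddAbove_iff] at hb
  obtain ⟨_, ⟨t, ht, rfl⟩, hM⟩ := hb M
  filter_upwards [Ioc_mem_nhdsGT ht] with s hs
  exact hM.le.trans (hG.antitoneOn hs.1 ht hs.2)

/-- Keep only `u ≤ 1`, where `e^{-u} ≥ e^{-1}` and `G (u / p) ≥ G (1 / p)`. This forces divergence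
when `G` is unbounded at `0+`. -/
theorem exp_neg_one_mul_le_realModulus {G : ℝ → ℝ} (hG : IsLICM G) {p : ℝ} (hp : 0 < p) :
    Real.exp (-1) * G (1 / p) ≤ realModulus G p := by
  have hint : IntegrableOn (fun u => Real.exp (-u) * G (u / p)) (Ioi 0) := by
    have := (integrableOn_Ioi_comp_mul_left_iff (fun t => Real.exp (-p * t) * G t) 0
      (a := 1 / p) (by positivity)).2 (by simpa using hG.integrableOn_exp_mul hp)
    refine this.congr_fun (fun u _ => ?_) measurableSet_Ioi
    simp only
    congr 2
    · field_simp
    · ring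
  have hpos : ∀ u ∈ Ioi (0 : ℝ), 0 ≤ Real.exp (-u) * G (u / p) := fun u hu =>
    mul_nonneg (Real.exp_nonneg _) (hG.1.nonneg (div_pos hu hp))
  rw [realModulus_eq_integral hp]
  calc Real.exp (-1) * G (1 / p) = ∫ _u in Ioc (0 : ℝ) 1, Real.exp (-1) * G (1 / p) := by simp
    _ ≤ ∫ u in Ioc (0 : ℝ) 1, Real.exp (-u) * G (u / p) := by
      refine setIntegral_mono_on (integrableOn_const (by simp)) (hint.mono_set Ioc_subset_Ioi_self)
        measurableSet_Ioc fun u hu => ?_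
      have h1 : G (1 / p) ≤ G (u / p) := hG.1.antitoneOn (div_pos hu.1 hp) (by
        simp only [mem_Ioi]; positivity) (by gcongr; exact hu.2)
      have h2 : 0 ≤ G (1 / p) := hG.1.nonneg (by positivity)
      have h3 := hu.2
      gcongr
    _ ≤ _ := setIntegral_mono_set hint
      (by filter_upwards [ae_restrict_mem measurableSet_Ioi] with u hu using hpos u hu)
      Ioc_subset_Ioi_self.eventuallyLE

theorem tendsto_realModulus_atTop {G : ℝ → ℝ} (hG : IsLICM G)
    (h : ¬ ∃ G₀ : ℝ, Tendsto G (𝓝[>] 0) (𝓝 G₀)) : Tendsto (realModulus G) atTop atTop := by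
  have h1 := ((hG.1.tendsto_atTop_of_not_exists h).comp
    (tendsto_const_div_atTop_nhdsGT zero_lt_one)).const_mul_atTop (Real.exp_pos (-1))
  refine tendsto_atTop_mono' _ ?_ h1
  filter_upwards [eventually_gt_atTop 0] with p hp using exp_neg_one_mul_le_realModulus hG hp

/-- For `p ≥ 1` the integrand is dominated by `1 / (1 + r)`, integrable by the spectral condition.
-/
theorem IsSpectralMeasure.tendsto_integral {ν : Measure ℝ} (hν : IsSpectralMeasure ν) :
    Tendsto (fun p : ℝ => ∫ r in Ioi (0 : ℝ), 1 / ((p : ℂ) + (r : ℂ)) ∂ν) atTop (𝓝 0) := by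
  have hint : Integrable (fun r : ℝ => 1 / (1 + r)) (ν.restrict (Ioi 0)) := by
    refine ⟨Measurable.aestronglyMeasurable (by fun_prop), ?_⟩
    rw [hasFiniteIntegral_iff_ofReal]
    · exact hν.2.2
    · filter_upwards [ae_restrict_mem measurableSet_Ioi] with r hr
      have hr0 : 0 < r := hr
      simp only [Pi.zero_apply]; positivity
  have h := tendsto_integral_filter_of_dominated_convergence (μ := ν.restrict (Ioi 0))
    (l := atTop) (F := fun (p : ℝ) (r : ℝ) => 1 / ((p : ℂ) + (r : ℂ))) (f := fun _ => 0)
    (fun r => 1 / (1 + r)) ?_ ?_ hint ?_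
  · simpa using h
  · exact Eventually.of_forall fun p => Measurable.aestronglyMeasurable (by fun_prop)
  · filter_upwards [eventually_ge_atTop 1] with p hp
    filter_upwards [ae_restrict_mem measurableSet_Ioi] with r hr
    have hr0 : 0 < r := hr
    rw [norm_div, norm_one, ← Complex.ofReal_add, Complex.norm_real,
      Real.norm_of_nonneg (by linarith)]
    gcongr
  · refine Eventually.of_forall fun r => ?_
    have h1 : Tendsto (fun p : ℝ => 1 / (p + r)) atTop (𝓝 0) :=
      tendsto_const_nhds.div_atTop (tendsto_atTop_add_const_right _ r tendsto_id)
    have h2 := (Complex.continuous_ofReal.tendsto 0).comp h1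
    simpa [Function.comp_def] using h2

theorem RepresentsWaveNumber.tendsto {ρ : ℝ} {G : ℝ → ℝ} (hG : IsLICM G)
    {Ginf : ℝ} (hpos : 0 < Ginf) (h : Tendsto G atTop (𝓝 Ginf)) {B : ℝ} {ν : Measure ℝ}
    (hB : RepresentsWaveNumber ρ G B ν) :
    Tendsto (fun p => √ρ / √(realModulus G p)) atTop (𝓝 B) := by
  have h1 : Tendsto (fun p : ℝ => (B : ℂ) + ∫ r in Ioi (0 : ℝ), 1 / ((p : ℂ) + (r : ℂ)) ∂ν) atTop
      (𝓝 (B : ℂ)) := by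
    simpa using hB.2.1.tendsto_integral.const_add (B : ℂ)
  have h2 := (Complex.continuous_re.tendsto _).comp h1
  rw [Complex.ofReal_re] at h2
  refine h2.congr' ?_
  filter_upwards [eventually_gt_atTop 0] with p hp
  have hp' : (p : ℂ) ≠ 0 := by exact_mod_cast hp.ne'
  have e := hB.2.2 p (by simpa using hp)
  rw [waveNumber, dispersionAttenuation, modulus_ofReal, mul_comm _ (p : ℂ), mul_div_assoc,
    mul_comm _ (p : ℂ), ← mul_add] at e
  have e' := mul_left_cancel₀ hp' e
  simp only [Function.comp]
  rw [← e', show (1 / 2 : ℂ) = ((1 / 2 : ℝ) : ℂ) by norm_num,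
    ← Complex.ofReal_cpow (hpos.le.trans (le_realModulus hG h hp)), ← Complex.ofReal_div,
    Complex.ofReal_re, ← Real.sqrt_eq_rpow]

end Viscoelastic

theorem mainTheorem7 (ρ : ℝ) (hρ : 0 < ρ) (G : ℝ → ℝ) (hG : Viscoelastic.IsLICM G)
    (Ginf : ℝ) (hGinf_pos : 0 < Ginf)
    (hGinf : Filter.Tendsto G Filter.atTop (nhds Ginf)) :
    (∃ (B : ℝ) (ν : MeasureTheory.Measure ℝ), Viscoelastic.RepresentsWaveNumber ρ G B ν) ∧
    ∀ (B : ℝ) (ν : MeasureTheory.Measure ℝ), Viscoelastic.RepresentsWaveNumber ρ G B ν →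
      (∀ G₀ : ℝ, Filter.Tendsto G (nhdsWithin 0 (Set.Ioi 0)) (nhds G₀) →
        B = Real.sqrt (ρ / G₀) ∧
        Viscoelastic.wavefrontSpeed B = ENNReal.ofReal (Real.sqrt (G₀ / ρ))) ∧
      ((¬ ∃ G₀ : ℝ, Filter.Tendsto G (nhdsWithin 0 (Set.Ioi 0)) (nhds G₀)) →
        B = 0 ∧ Viscoelastic.wavefrontSpeed B = ⊤) := by
  refine ⟨Viscoelastic.exists_representsWaveNumber hG hGinf_pos hGinf, fun B ν hB => ⟨?_, ?_⟩⟩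
  · intro G₀ hG₀
    -- Compare through the value at `1`: `Ginf ≤ G 1 ≤ G₀`.
    have hpos : 0 < G₀ := hGinf_pos.trans_le
      ((hG.1.le_of_tendsto hGinf zero_lt_one).trans (hG.1.le_of_tendsto_zero hG₀ zero_lt_one))
    have hlim : Filter.Tendsto (fun p => √ρ / √(Viscoelastic.realModulus G p)) Filter.atTop
        (nhds (√ρ / √G₀)) :=
      tendsto_const_nhds.div ((Real.continuous_sqrt.tendsto G₀).comp
        (Viscoelastic.tendsto_realModulus hG hG₀)) (Real.sqrt_pos.2 hpos).ne'
    have hBe : B = √(ρ / G₀) := by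
      rw [tendsto_nhds_unique (hB.tendsto hG hGinf_pos hGinf) hlim, Real.sqrt_div hρ.le]
    refine ⟨hBe, ?_⟩
    rw [Viscoelastic.wavefrontSpeed, hBe,
      ← ENNReal.ofReal_inv_of_pos (Real.sqrt_pos.2 (div_pos hρ hpos)), ← Real.sqrt_inv, inv_div]
  · intro hno
    have hlim : Filter.Tendsto (fun p => √ρ / √(Viscoelastic.realModulus G p)) Filter.atTop
        (nhds 0) :=
      tendsto_const_nhds.div_atTop (Real.tendsto_sqrt_atTop.comp
        (Viscoelastic.tendsto_realModulus_atTop hG hno))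
    have hBe : B = 0 := tendsto_nhds_unique (hB.tendsto hG hGinf_pos hGinf) hlim
    exact ⟨hBe, by simp [Viscoelastic.wavefrontSpeed, hBe]⟩
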